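/- Let $x,y,z$ be the coordinates of $\mathbb{R}^3$, let $\partial_1,\partial_2,\partial_3$ be the corresponding partial derivatives, and write $\partial_{ij}=\partial_i\wedge\partial_j$, $\partial_{123}=\partial_1\wedge\partial_2\wedge\partial_3$. Put $$Y_1=x\partial_1+y\partial_2,\qquad Y_2=x\partial_2,\qquad Y_3=z\partial_3,\qquad Y_{ij}=Y_i\wedge Y_j .$$ For $a\in\mathbb{R}$ let $$\Lambda_3=2Y_{23}+aY_{31}+Y_{12}=(2x-ay)z\,\partial_{23}+a\,xz\,\partial_{31}+x^2\,\partial_{12}.$$ Let $\mathcal{R}^p=\mathbb{R}[[x,y,z]]\otimes\bigwedge^p\mathbb{R}^3$ be the space of formal $p$-vector fields and let $[\cdot,\cdot]$ be the Schouten–Nijenhuis bracket. Then $\Lambda_3$ is a Poisson tensor, i.e. $[\Lambda_3,\Lambda_3]=0$, so that $\partial_{\Lambda_3}=[\Lambda_3,\cdot]$ makes $$0\to\mathcal{R}^0\to\mathcal{R}^1\to\mathcal{R}^2\to\mathcal{R}^3\to 0$$ a complex; denote by $LH^p(\mathcal{R},\Lambda_3)$ its cohomology spaces (the formal Poisson cohomology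 of $\Lambda_3$). If $a\neq 0$, then, as real vector spaces, and with each multivector field on the right standing for a cocycle whose class is meant, $$LH^0(\mathcal{R},\Lambda_3)=\mathbb{R},\qquad LH^1(\mathcal{R},\Lambda_3)=\mathbb{R}Y_1\oplus\mathbb{R}Y_2\oplus\mathbb{R}Y_3,$$ $$LH^2(\mathcal{R},\Lambda_3)=\mathbb{R}Y_{23}\oplus\mathbb{R}Y_{31}\oplus\mathbb{R}\,(2yz\,\partial_{31}+y^2\,\partial_{12}),$$ $$LH^3(\mathcal{R},\Lambda_3)=\mathbb{R}\,\partial_{123}\oplus\mathbb{R}\,y^2z\,\partial_{123}.$$ That is, in each degree $p\in\{0,1,2,3\}$ the listed fields (the constant $1$ for $p=0$) are cocycles and their classes form a basis of $LH^p(\mathcal{R},\Lambda_3)$; the cohomology vanishes in degrees $p>3$. -/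

import Mathlib

open scoped TensorProduct

noncomputable section

/-- Formal multivector fields on `ℝⁿ`: multivectors with coefficients in the formal power series,
`ℝ[[x₁, …, xₙ]] ⊗ ⋀ℝⁿ`, with the wedge product as multiplication. -/
def FormalMultivector (n : ℕ) : Type :=
  MvPowerSeries (Fin n) ℝ ⊗[ℝ] ExteriorAlgebra ℝ (Fin n → ℝ)

namespace FormalMultivector

variable {n : ℕ}

instance : Ring (FormalMultivector n) :=
  inferInstanceAs (Ring (MvPowerSeries (Fin n) ℝ ⊗[ℝ] ExteriorAlgebra ℝ (Fin n → ℝ)))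

instance : Algebra ℝ (FormalMultivector n) :=
  inferInstanceAs (Algebra ℝ (MvPowerSeries (Fin n) ℝ ⊗[ℝ] ExteriorAlgebra ℝ (Fin n → ℝ)))

/-- A formal power series, as a multivector field of degree `0`. -/
def ofSeries (f : MvPowerSeries (Fin n) ℝ) : FormalMultivector n := f ⊗ₜ[ℝ] 1

/-- The coordinate vector field `∂ᵢ = ∂/∂xᵢ`. -/
def coordField (i : Fin n) : FormalMultivector n :=
  1 ⊗ₜ[ℝ] ExteriorAlgebra.ι ℝ (Pi.single i (1 : ℝ))

/-- The space of formal multivector fields of degree `p`, `ℝ[[x₁, …, xₙ]] ⊗ ⋀ᵖℝⁿ`. -/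
def homogeneous (n p : ℕ) : Submodule ℝ (FormalMultivector n) :=
  LinearMap.range
    (LinearMap.lTensor (MvPowerSeries (Fin n) ℝ) (⋀[ℝ]^p (Fin n → ℝ)).subtype)

/-- Differentiation of the coefficients with respect to `xᵢ`. -/
def partialDeriv (i : Fin n) : FormalMultivector n →ₗ[ℝ] FormalMultivector n :=
  LinearMap.rTensor (ExteriorAlgebra ℝ (Fin n → ℝ))
    (MvPowerSeries.pderiv ℝ i : Derivation ℝ (MvPowerSeries (Fin n) ℝ) _).toLinearMap

/-- The interior product with `dxᵢ`: the antiderivation over the power series that sends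
`∂ⱼ` to `δᵢⱼ`. -/
def interior (i : Fin n) : FormalMultivector n →ₗ[ℝ] FormalMultivector n :=
  LinearMap.lTensor (MvPowerSeries (Fin n) ℝ)
    (CliffordAlgebra.contractLeft (Q := (0 : QuadraticForm ℝ (Fin n → ℝ))) (LinearMap.proj i))

/-- The sign operator: multiplication by `(-1)ᵖ` in degree `p`. -/
def parity : FormalMultivector n →ₗ[ℝ] FormalMultivector n :=
  LinearMap.lTensor (MvPowerSeries (Fin n) ℝ)
    (CliffordAlgebra.involute (Q := (0 : QuadraticForm ℝ (Fin n → ℝ)))).toLinearMap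

/-- The Schouten–Nijenhuis bracket. On `P` of degree `p` and arbitrary `Q` it is
`[P, Q] = ∑ᵢ ((-1)ᵖ⁻¹ (ι_{dxᵢ} P) ∧ ∂ᵢQ - ∂ᵢP ∧ ι_{dxᵢ} Q)`. -/
def schouten : FormalMultivector n →ₗ[ℝ] FormalMultivector n →ₗ[ℝ] FormalMultivector n :=
  ∑ i : Fin n,
    ((LinearMap.mul ℝ (FormalMultivector n)).compl₁₂ (parity ∘ₗ interior i) (partialDeriv i)
      - (LinearMap.mul ℝ (FormalMultivector n)).compl₁₂ (partialDeriv i) (interior i))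

theorem schouten_apply (P Q : FormalMultivector n) :
    schouten P Q =
      ∑ i : Fin n, (parity (interior i P) * partialDeriv i Q - partialDeriv i P * interior i Q) := by
  simp [schouten]

/-- The Lichnerowicz–Poisson cocycles of degree `p`: the kernel of `[Λ, ·]` in degree `p`. -/
def cocycles (Λ : FormalMultivector n) (p : ℕ) : Submodule ℝ (FormalMultivector n) :=
  homogeneous n p ⊓ LinearMap.ker (schouten Λ)

/-- The Lichnerowicz–Poisson coboundaries of degree `p`: the image of degree `p - 1`
under `[Λ, ·]`, which is zero for `p = 0`. -/
def coboundaries (Λ : FormalMultivector n) : ℕ → Submodule ℝ (FormalMultivector n)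
  | 0 => ⊥
  | p + 1 => (homogeneous n p).map (schouten Λ)

/-- The formal Poisson cohomology space in degree `p`: cocycles modulo coboundaries. -/
abbrev Cohomology (Λ : FormalMultivector n) (p : ℕ) : Type :=
  cocycles Λ p ⧸ (coboundaries Λ p).submoduleOf (cocycles Λ p)

/-- The multivector fields `C i` are cocycles of degree `p`, and their classes form a basis of the
cohomology space in degree `p`. -/
def RepresentsBasis {κ : Type} (Λ : FormalMultivector n) (p : ℕ) (C : κ → FormalMultivector n) :
    Prop :=
  ∃ h : ∀ i, C i ∈ cocycles Λ p, ∃ b : Module.Basis κ ℝ (Cohomology Λ p),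
    ∀ i, b i = Submodule.Quotient.mk ⟨C i, h i⟩

end FormalMultivector

namespace DufourHaraki

open FormalMultivector

/-- The coordinate function `x` on `ℝ³`. -/
def x : FormalMultivector 3 := ofSeries (MvPowerSeries.X 0)
/-- The coordinate function `y`. -/
def y : FormalMultivector 3 := ofSeries (MvPowerSeries.X 1)
/-- The coordinate function `z`. -/
def z : FormalMultivector 3 := ofSeries (MvPowerSeries.X 2)

/-- The coordinate vector field `∂₁` on `ℝ³`. -/
def d1 : FormalMultivector 3 := coordField 0
/-- The coordinate vector field `∂₂`. -/
def d2 : FormalMultivector 3 := coordField 1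
/-- The coordinate vector field `∂₃`. -/
def d3 : FormalMultivector 3 := coordField 2

/-- `Y₁ = x∂₁ + y∂₂`. -/
def Y1 : FormalMultivector 3 := x * d1 + y * d2
/-- `Y₂ = x∂₂`. -/
def Y2 : FormalMultivector 3 := x * d2
/-- `Y₃ = z∂₃`. -/
def Y3 : FormalMultivector 3 := z * d3

/-- The quadratic Poisson structure `2 Y₂ ∧ Y₃ + a Y₃ ∧ Y₁ + Y₁ ∧ Y₂`. -/
def Λ3 (a : ℝ) : FormalMultivector 3 := (2 : ℝ) • (Y2 * Y3) + a • (Y3 * Y1) + Y1 * Y2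

end DufourHaraki

end

/-!
Write `Λ₃ = x²∂₁₂ + Y₃ ∧ W` with `W = aY₁ - 2Y₂`, a linear vector field in the plane. Writing `D`
for `[x²∂₁₂, ·] - M(W ∧ ·)` with `M = z∂_z`, and counting `∂₃` with weight `-1` in `z`, the bracket
with `Λ₃` becomes the mapping cone of the Lie derivative `L` along `W` on the planar complex
`functions → planar vector fields → planar bivector fields` with differential `D` (`planar0`,
`planar1`). Both `D` and `L` respect the weight `m` in `z`, so the complex splits into three parts.

* `m = -1`: only the components along `∂₃` that do not involve `z` occur, and the part is the
  planar complex with `M = -1`.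
* `m ≥ 1`: the cone of `L` on the planar complex, with `M` invertible.
* `m = 0`: the cone of `L` on the planar complex with `M = 0`.

If `M` is invertible, the planar complex is exact except at bivector fields, where its cohomology
is represented by the series in `z` alone (`exists_planar0_eq`, `exists_eq_planar1_add`): a planar
cocycle has first component divisible by `x`, and `x∂_y - aM` is invertible on formal power series
because `x∂_y` is nilpotent on forms of each degree and `a ≠ 0`. Hence the part `m = -1` contributes
just the class of `∂₁₂₃`. For `m ≥ 1` the Lie derivative acts as `-2a ≠ 0` on that cohomology, so
the cone is exact.

For `m = 0` the Lie derivative `L = a(x∂_x + y∂_y) - 2x∂_y` on functions is invertible on forms of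
degree different from `0`; on planar vector fields and bivector fields the exceptional degrees of
the coefficients are `1` and `2` (`exists_eq_op_add_form`, `isForm_of_op`). As the cone of an
invertible map is exact, only constant, linear and quadratic coefficients matter, and the remaining
finite linear algebra produces `1`; `Y₁`, `Y₂`, `Y₃`; `Y₂₃`, `Y₃₁`, `2yz∂₃₁ + y²∂₁₂`; and `y²z∂₁₂₃`.
That no combination of these is a coboundary is read off from single coefficients.
-/

/-! ### Multivector fields as power series times constant multivectors -/

namespace FormalMultivector

open MvPowerSeries

/-- The inclusion of the power series as the multivector fields of degree `0`. -/
noncomputable def ofSeriesHom (n : ℕ) : MvPowerSeries (Fin n) ℝ →+* FormalMultivector n where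
  toFun := ofSeries
  map_one' := rfl
  map_zero' := TensorProduct.zero_tmul _ _
  map_add' _ _ := TensorProduct.add_tmul _ _ _
  map_mul' f g := by
    refine Eq.symm ((Algebra.TensorProduct.tmul_mul_tmul _ _ _ _).trans ?_)
    rw [mul_one]; rfl

/-- Multiplication of multivector fields by power series. -/
noncomputable instance (n : ℕ) : Module (MvPowerSeries (Fin n) ℝ) (FormalMultivector n) :=
  Module.compHom _ (ofSeriesHom n)

instance (n : ℕ) : IsScalarTower ℝ (MvPowerSeries (Fin n) ℝ) (FormalMultivector n) where
  smul_assoc c f P := by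
    change ofSeries (c • f) * P = c • (ofSeries f * P)
    rw [← smul_mul_assoc]; rfl

/-- The multivector field with constant coefficients given by `ω`. -/
noncomputable def const {n : ℕ} (ω : ExteriorAlgebra ℝ (Fin n → ℝ)) : FormalMultivector n :=
  1 ⊗ₜ[ℝ] ω

/-- The basis vector `eᵢ` in the exterior algebra. -/
noncomputable def basisVec {n : ℕ} (i : Fin n) : ExteriorAlgebra ℝ (Fin n → ℝ) :=
  ExteriorAlgebra.ι ℝ (Pi.single i (1 : ℝ))

variable {n : ℕ} (f g : MvPowerSeries (Fin n) ℝ) (ω η : ExteriorAlgebra ℝ (Fin n → ℝ)) (i j : Fin n)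

theorem smul_const : f • (const ω : FormalMultivector n) = f ⊗ₜ[ℝ] ω := by
  refine (Algebra.TensorProduct.tmul_mul_tmul _ _ _ _).trans ?_
  rw [mul_one, one_mul]

theorem ofSeries_eq : ofSeries f = f • (const 1 : FormalMultivector n) := (smul_const _ _).symm

theorem const_neg : (const (-ω) : FormalMultivector n) = -const ω :=
  TensorProduct.tmul_neg _ _

theorem const_zero : (const 0 : FormalMultivector n) = 0 :=
  TensorProduct.tmul_zero _ _

theorem const_add : (const (ω + η) : FormalMultivector n) = const ω + const η :=
  TensorProduct.tmul_add _ _ _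

theorem smul_const_mul_smul_const :
    (f • const ω) * (g • const η) = (f * g) • (const (ω * η) : FormalMultivector n) := by
  simp only [smul_const]
  exact Algebra.TensorProduct.tmul_mul_tmul _ _ _ _

theorem partialDeriv_smul_const :
    partialDeriv i (f • const ω) = (pderiv ℝ i f) • (const ω : FormalMultivector n) := by
  simp only [smul_const]; rfl

theorem interior_smul_const :
    interior i (f • const ω) = f • (const
      (CliffordAlgebra.contractLeft (Q := (0 : QuadraticForm ℝ (Fin n → ℝ)))
        (LinearMap.proj i) ω) : FormalMultivector n) := by
  simp only [smul_const]; rfl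

theorem parity_smul_const :
    parity (f • const ω) = f • (const
      (CliffordAlgebra.involute (Q := (0 : QuadraticForm ℝ (Fin n → ℝ))) ω) :
        FormalMultivector n) := by
  simp only [smul_const]; rfl

theorem contractLeft_basisVec_mul :
    CliffordAlgebra.contractLeft (Q := (0 : QuadraticForm ℝ (Fin n → ℝ))) (LinearMap.proj i)
      (basisVec j * ω) = (if i = j then (1 : ℝ) else 0) • ω -
        basisVec j * CliffordAlgebra.contractLeft
          (Q := (0 : QuadraticForm ℝ (Fin n → ℝ))) (LinearMap.proj i) ω := by
  refine (CliffordAlgebra.contractLeft_ι_mul _ _ _).trans ?_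
  simp [Pi.single_apply]; rfl

theorem contractLeft_one' :
    CliffordAlgebra.contractLeft (Q := (0 : QuadraticForm ℝ (Fin n → ℝ))) (LinearMap.proj i)
      (1 : ExteriorAlgebra ℝ (Fin n → ℝ)) = 0 :=
  CliffordAlgebra.contractLeft_one _ _

theorem contractLeft_basisVec :
    CliffordAlgebra.contractLeft (Q := (0 : QuadraticForm ℝ (Fin n → ℝ))) (LinearMap.proj i)
      (basisVec j) = if i = j then 1 else 0 := by
  have h := contractLeft_basisVec_mul 1 i j
  rw [mul_one, contractLeft_one', mul_zero, sub_zero] at h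
  rw [h]
  split_ifs <;> simp

theorem involute_basisVec :
    CliffordAlgebra.involute (Q := (0 : QuadraticForm ℝ (Fin n → ℝ))) (basisVec i) =
      -basisVec i :=
  CliffordAlgebra.involute_ι _

theorem basisVec_mul_self : basisVec i * basisVec i = 0 := ExteriorAlgebra.ι_sq_zero _

theorem basisVec_mul_self_mul : basisVec i * (basisVec i * ω) = 0 := by
  rw [← mul_assoc, basisVec_mul_self, zero_mul]

theorem basisVec_mul_swap : basisVec j * basisVec i = -(basisVec i * basisVec j) :=
  eq_neg_of_add_eq_zero_left (ExteriorAlgebra.ι_add_mul_swap _ _)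

theorem basisVec_mul_swap_mul :
    basisVec j * (basisVec i * ω) = -(basisVec i * (basisVec j * ω)) := by
  rw [← mul_assoc, basisVec_mul_swap, neg_mul, mul_assoc]

/-! ### Homogeneous multivector fields -/

theorem ofSeries_injective :
    Function.Injective (ofSeries : MvPowerSeries (Fin n) ℝ → FormalMultivector n) := by
  intro f g h
  have h' := congrArg (fun P : MvPowerSeries (Fin n) ℝ ⊗[ℝ] ExteriorAlgebra ℝ (Fin n → ℝ) =>
    TensorProduct.rid ℝ _ (LinearMap.lTensor (MvPowerSeries (Fin n) ℝ)
      (ExteriorAlgebra.algebraMapInv (R := ℝ) (M := Fin n → ℝ)).toLinearMap P)) h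
  simpa [ofSeries] using h'

theorem smul_const_mem_homogeneous {p : ℕ} {ω : ExteriorAlgebra ℝ (Fin n → ℝ)}
    (h : ω ∈ ⋀[ℝ]^p (Fin n → ℝ)) : f • const ω ∈ homogeneous n p :=
  ⟨f ⊗ₜ ⟨ω, h⟩, (smul_const f ω).symm⟩

/-- A subspace contains all fields of degree `p` as soon as it contains the products of power series
with a spanning set of `⋀ᵖℝⁿ`. -/
theorem homogeneous_le {p : ℕ} {s : Set (ExteriorAlgebra ℝ (Fin n → ℝ))}
    (hs : ⋀[ℝ]^p (Fin n → ℝ) = Submodule.span ℝ s) {V : Submodule ℝ (FormalMultivector n)}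
    (hV : ∀ f : MvPowerSeries (Fin n) ℝ, ∀ ω ∈ s, f • const ω ∈ V) : homogeneous n p ≤ V := by
  rintro _ ⟨t, rfl⟩
  set φ := LinearMap.lTensor (MvPowerSeries (Fin n) ℝ) (⋀[ℝ]^p (Fin n → ℝ)).subtype
  induction t using TensorProduct.induction_on with
  | zero => exact (congrArg (· ∈ V) (map_zero φ)).mpr V.zero_mem
  | add t u ht hu => exact (congrArg (· ∈ V) (map_add φ t u)).mpr (V.add_mem ht hu)
  | tmul f ω =>
    obtain ⟨ω, hω⟩ := ω
    change f ⊗ₜ[ℝ] ω ∈ V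
    rw [← smul_const]
    rw [hs] at hω
    induction hω using Submodule.span_induction with
    | mem ω h => exact hV f ω h
    | zero => rw [const_zero, smul_zero]; exact V.zero_mem
    | add ω η _ _ hω hη => rw [const_add, smul_add]; exact V.add_mem hω hη
    | smul c ω _ hω =>
      have : f • const (c • ω) = c • f • (const ω : FormalMultivector n) := by
        rw [smul_const, smul_const]; exact TensorProduct.tmul_smul _ _ _
      rw [this]; exact V.smul_mem c hω

open scoped Pointwise in
theorem exteriorPower_eq_span (n p : ℕ) : ⋀[ℝ]^p (Fin n → ℝ) =
    Submodule.span ℝ ((Set.range (basisVec (n := n))) ^ p) := by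
  rw [← Submodule.span_pow]
  change LinearMap.range (ExteriorAlgebra.ι ℝ) ^ p = _
  congr 1
  rw [LinearMap.range_eq_map, ← (Pi.basisFun ℝ (Fin n)).span_eq, Submodule.map_span,
    ← Set.range_comp]
  congr 2
  ext i
  simp [basisVec]

theorem homogeneous_eq_bot {p : ℕ} (hp : n < p) : homogeneous n p = ⊥ := by
  have h : ⋀[ℝ]^p (Fin n → ℝ) = ⊥ := by
    rw [← Submodule.finrank_eq_zero (R := ℝ), exteriorPower.finrank_eq, Module.finrank_fin_fun,
      Nat.choose_eq_zero_of_lt hp]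
  refine le_bot_iff.1 (homogeneous_le (s := ∅) (by rw [h, Submodule.span_empty]) ?_)
  simp

end FormalMultivector

/-! ### Components of multivector fields on `ℝ³` and of the bracket with a bivector field -/

namespace DufourHaraki

open FormalMultivector MvPowerSeries

/-- Formal power series in the coordinates `x`, `y`, `z`. -/
abbrev Ser : Type := MvPowerSeries (Fin 3) ℝ

/-- The function `f`, as a multivector field of degree `0`. -/
noncomputable def field0 : Ser →ₗ[ℝ] FormalMultivector 3 where
  toFun f := f • const 1
  map_add' f g := add_smul f g _
  map_smul' c f := smul_assoc c f _

/-- The vector field `P₁∂₁ + P₂∂₂ + P₃∂₃`, encoded as `((P₁, P₂), P₃)`. -/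
noncomputable def field1 : (Ser × Ser) × Ser →ₗ[ℝ] FormalMultivector 3 where
  toFun P := P.1.1 • const (basisVec 0) + P.1.2 • const (basisVec 1) + P.2 • const (basisVec 2)
  map_add' P Q := by simp only [Prod.fst_add, Prod.snd_add, add_smul]; abel
  map_smul' c P := by
    simp only [Prod.smul_fst, Prod.smul_snd, smul_assoc, smul_add, RingHom.id_apply]

/-- The bivector field `g∂₁₂ + B₁∂₁₃ + B₂∂₂₃`, encoded as `(g, (B₁, B₂))`. -/
noncomputable def field2 : Ser × (Ser × Ser) →ₗ[ℝ] FormalMultivector 3 where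
  toFun S := S.1 • const (basisVec 0 * basisVec 1) + S.2.1 • const (basisVec 0 * basisVec 2) +
    S.2.2 • const (basisVec 1 * basisVec 2)
  map_add' P Q := by simp only [Prod.fst_add, Prod.snd_add, add_smul]; abel
  map_smul' c P := by
    simp only [Prod.smul_fst, Prod.smul_snd, smul_assoc, smul_add, RingHom.id_apply]

/-- The trivector field `t∂₁₂₃`. -/
noncomputable def field3 : Ser →ₗ[ℝ] FormalMultivector 3 where
  toFun t := t • const (basisVec 0 * (basisVec 1 * basisVec 2))
  map_add' f g := add_smul f g _
  map_smul' c f := smul_assoc c f _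

theorem field0_apply (f : Ser) : field0 f = f • const 1 := rfl

theorem field1_apply (P : (Ser × Ser) × Ser) : field1 P =
    P.1.1 • const (basisVec 0) + P.1.2 • const (basisVec 1) + P.2 • const (basisVec 2) := rfl

theorem field2_apply (S : Ser × (Ser × Ser)) : field2 S =
    S.1 • const (basisVec 0 * basisVec 1) + S.2.1 • const (basisVec 0 * basisVec 2) +
      S.2.2 • const (basisVec 1 * basisVec 2) := rfl

theorem field3_apply (t : Ser) :
    field3 t = t • const (basisVec 0 * (basisVec 1 * basisVec 2)) := rfl

theorem schouten_field2_field0 (g B₁ B₂ f : Ser) :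
    schouten (field2 (g, (B₁, B₂))) (field0 f) =
      field1 ((g * pderiv ℝ 1 f + B₁ * pderiv ℝ 2 f, -(g * pderiv ℝ 0 f) + B₂ * pderiv ℝ 2 f),
        -(B₁ * pderiv ℝ 0 f) - B₂ * pderiv ℝ 1 f) := by
  simp [schouten_apply, Fin.sum_univ_three, field2_apply, field0_apply, field1_apply,
    partialDeriv_smul_const, interior_smul_const, parity_smul_const, contractLeft_basisVec_mul,
    contractLeft_basisVec, const_zero, const_neg, involute_basisVec,
    smul_const_mul_smul_const]
  simp only [add_smul, sub_smul, neg_smul]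
  abel

theorem schouten_field2_field1 (g B₁ B₂ P₁ P₂ P₃ : Ser) :
    schouten (field2 (g, (B₁, B₂))) (field1 ((P₁, P₂), P₃)) = field2
      (g * pderiv ℝ 0 P₁ + g * pderiv ℝ 1 P₂ + B₁ * pderiv ℝ 2 P₂ - B₂ * pderiv ℝ 2 P₁
          - (P₁ * pderiv ℝ 0 g + P₂ * pderiv ℝ 1 g + P₃ * pderiv ℝ 2 g),
        (g * pderiv ℝ 1 P₃ + B₁ * pderiv ℝ 0 P₁ + B₁ * pderiv ℝ 2 P₃ + B₂ * pderiv ℝ 1 P₁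
          - (P₁ * pderiv ℝ 0 B₁ + P₂ * pderiv ℝ 1 B₁ + P₃ * pderiv ℝ 2 B₁),
        -(g * pderiv ℝ 0 P₃) + B₁ * pderiv ℝ 0 P₂ + B₂ * pderiv ℝ 1 P₂ + B₂ * pderiv ℝ 2 P₃
          - (P₁ * pderiv ℝ 0 B₂ + P₂ * pderiv ℝ 1 B₂ + P₃ * pderiv ℝ 2 B₂))) := by
  have h10 := basisVec_mul_swap (n := 3) 0 1
  have h20 := basisVec_mul_swap (n := 3) 0 2
  have h21 := basisVec_mul_swap (n := 3) 1 2
  simp [schouten_apply, Fin.sum_univ_three, field2_apply, field1_apply, partialDeriv_smul_const,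
    interior_smul_const, parity_smul_const, contractLeft_basisVec_mul, contractLeft_basisVec,
    const_zero, const_neg, involute_basisVec, smul_const_mul_smul_const, mul_add,
    basisVec_mul_self, h10, h20, h21]
  simp only [add_smul, sub_smul, neg_smul, mul_comm]
  abel

theorem schouten_field2_field2 (g B₁ B₂ h C₁ C₂ : Ser) :
    schouten (field2 (g, (B₁, B₂))) (field2 (h, (C₁, C₂))) = field3
      (g * pderiv ℝ 0 C₁ + g * pderiv ℝ 1 C₂ - C₁ * pderiv ℝ 0 g - C₂ * pderiv ℝ 1 g
        - B₁ * pderiv ℝ 0 h + B₁ * pderiv ℝ 2 C₂ + h * pderiv ℝ 0 B₁ - C₂ * pderiv ℝ 2 B₁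
        - B₂ * pderiv ℝ 1 h - B₂ * pderiv ℝ 2 C₁ + h * pderiv ℝ 1 B₂ + C₁ * pderiv ℝ 2 B₂) := by
  have h10 := basisVec_mul_swap (n := 3) 0 1
  have h20 := basisVec_mul_swap (n := 3) 0 2
  have h21 := basisVec_mul_swap (n := 3) 1 2
  have h10' := fun ω => basisVec_mul_swap_mul (n := 3) ω 0 1
  have h20' := fun ω => basisVec_mul_swap_mul (n := 3) ω 0 2
  have h21' := fun ω => basisVec_mul_swap_mul (n := 3) ω 1 2
  simp [schouten_apply, Fin.sum_univ_three, field2_apply, field3_apply, partialDeriv_smul_const,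
    interior_smul_const, parity_smul_const, contractLeft_basisVec_mul, contractLeft_basisVec,
    const_zero, const_neg, involute_basisVec, smul_const_mul_smul_const, mul_add, mul_assoc,
    basisVec_mul_self, basisVec_mul_self_mul, h10, h20, h21, h10', h20', h21']
  simp only [add_smul, sub_smul, mul_comm]
  abel

theorem schouten_field2_field3 (g B₁ B₂ t : Ser) :
    schouten (field2 (g, (B₁, B₂))) (field3 t) = 0 := by
  have h21 := basisVec_mul_swap (n := 3) 1 2
  have h10' := fun ω => basisVec_mul_swap_mul (n := 3) ω 0 1
  have h20' := fun ω => basisVec_mul_swap_mul (n := 3) ω 0 2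
  have h21' := fun ω => basisVec_mul_swap_mul (n := 3) ω 1 2
  simp [schouten_apply, Fin.sum_univ_three, field2_apply, field3_apply, partialDeriv_smul_const,
    interior_smul_const, parity_smul_const, contractLeft_basisVec_mul, contractLeft_basisVec,
    const_zero, involute_basisVec, smul_const_mul_smul_const, mul_assoc, basisVec_mul_self,
    basisVec_mul_self_mul, h21, h10', h20', h21']

/-! ### Each degree is parametrized by its components -/

theorem field0_injective : Function.Injective field0 := by
  intro f g h
  simp only [field0_apply, ← ofSeries_eq] at h
  exact ofSeries_injective h

theorem interior_zero_field1 (P : (Ser × Ser) × Ser) : interior 0 (field1 P) = field0 P.1.1 := by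
  simp [field0_apply, field1_apply, interior_smul_const, contractLeft_basisVec, const_zero]

theorem interior_one_field1 (P : (Ser × Ser) × Ser) : interior 1 (field1 P) = field0 P.1.2 := by
  simp [field0_apply, field1_apply, interior_smul_const, contractLeft_basisVec, const_zero]

theorem interior_two_field1 (P : (Ser × Ser) × Ser) : interior 2 (field1 P) = field0 P.2 := by
  simp [field0_apply, field1_apply, interior_smul_const, contractLeft_basisVec, const_zero]

theorem field1_injective : Function.Injective field1 := by
  intro P Q h
  refine Prod.ext (Prod.ext ?_ ?_) ?_ <;> apply field0_injective
  · rw [← interior_zero_field1, h, interior_zero_field1]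
  · rw [← interior_one_field1, h, interior_one_field1]
  · rw [← interior_two_field1, h, interior_two_field1]

theorem interior_zero_field2 (S : Ser × (Ser × Ser)) :
    interior 0 (field2 S) = field1 ((0, S.1), S.2.1) := by
  simp [field2_apply, field1_apply, interior_smul_const, contractLeft_basisVec,
    contractLeft_basisVec_mul, const_zero]

theorem interior_one_field2 (S : Ser × (Ser × Ser)) :
    interior 1 (field2 S) = field1 ((-S.1, 0), S.2.2) := by
  simp [field2_apply, field1_apply, interior_smul_const, contractLeft_basisVec,
    contractLeft_basisVec_mul, const_zero, const_neg]

theorem field2_injective : Function.Injective field2 := by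
  intro S T h
  have h0 := field1_injective
    ((interior_zero_field2 S).symm.trans ((congrArg _ h).trans (interior_zero_field2 T)))
  have h1 := field1_injective
    ((interior_one_field2 S).symm.trans ((congrArg _ h).trans (interior_one_field2 T)))
  simp only [Prod.mk.injEq] at h0 h1
  exact Prod.ext h0.1.2 (Prod.ext h0.2 h1.2)

theorem interior_zero_field3 (t : Ser) : interior 0 (field3 t) = field2 (0, (0, t)) := by
  simp [field3_apply, field2_apply, interior_smul_const, contractLeft_basisVec,
    contractLeft_basisVec_mul]

theorem field3_injective : Function.Injective field3 := by
  intro s t h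
  have h0 := field2_injective
    ((interior_zero_field3 s).symm.trans ((congrArg _ h).trans (interior_zero_field3 t)))
  simpa using h0

section

open scoped Pointwise

theorem basisVec_mem (i : Fin 3) : basisVec i ∈ ⋀[ℝ]^1 (Fin 3 → ℝ) := by
  rw [exteriorPower_eq_span, pow_one]
  exact Submodule.subset_span ⟨i, rfl⟩

theorem basisVec_mul_basisVec_mem (i j : Fin 3) :
    basisVec i * basisVec j ∈ ⋀[ℝ]^2 (Fin 3 → ℝ) := by
  rw [exteriorPower_eq_span, pow_two]
  exact Submodule.subset_span (Set.mul_mem_mul ⟨i, rfl⟩ ⟨j, rfl⟩)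

theorem basisVec_mul_basisVec_mul_basisVec_mem (i j k : Fin 3) :
    basisVec i * (basisVec j * basisVec k) ∈ ⋀[ℝ]^3 (Fin 3 → ℝ) := by
  rw [exteriorPower_eq_span, pow_succ', pow_two]
  exact Submodule.subset_span (Set.mul_mem_mul ⟨i, rfl⟩ (Set.mul_mem_mul ⟨j, rfl⟩ ⟨k, rfl⟩))

theorem homogeneous_zero_eq : homogeneous 3 0 = LinearMap.range field0 := by
  apply le_antisymm
  · refine homogeneous_le (exteriorPower_eq_span 3 0) ?_
    intro f ω h
    rw [pow_zero, Set.mem_one] at h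
    exact ⟨f, by rw [h, field0_apply]⟩
  · rintro _ ⟨f, rfl⟩
    refine smul_const_mem_homogeneous f ?_
    rw [exteriorPower_eq_span, pow_zero]
    exact Submodule.subset_span rfl

theorem homogeneous_one_eq : homogeneous 3 1 = LinearMap.range field1 := by
  apply le_antisymm
  · refine homogeneous_le (exteriorPower_eq_span 3 1) ?_
    intro f ω h
    rw [pow_one] at h
    obtain ⟨i, rfl⟩ := h
    fin_cases i
    · exact ⟨((f, 0), 0), by simp [field1_apply]⟩
    · exact ⟨((0, f), 0), by simp [field1_apply]⟩
    · exact ⟨((0, 0), f), by simp [field1_apply]⟩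
  · rintro _ ⟨P, rfl⟩
    rw [field1_apply]
    exact add_mem (add_mem (smul_const_mem_homogeneous _ (basisVec_mem _))
      (smul_const_mem_homogeneous _ (basisVec_mem _)))
      (smul_const_mem_homogeneous _ (basisVec_mem _))

theorem homogeneous_two_eq : homogeneous 3 2 = LinearMap.range field2 := by
  have h10 := basisVec_mul_swap (n := 3) 0 1
  have h20 := basisVec_mul_swap (n := 3) 0 2
  have h21 := basisVec_mul_swap (n := 3) 1 2
  apply le_antisymm
  · refine homogeneous_le (exteriorPower_eq_span 3 2) ?_
    intro f ω h
    rw [pow_two] at h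
    obtain ⟨_, ⟨i, rfl⟩, _, ⟨j, rfl⟩, rfl⟩ := h
    have h01 : f • const (basisVec 0 * basisVec 1) ∈ LinearMap.range field2 :=
      ⟨(f, (0, 0)), by simp [field2_apply]⟩
    have h02 : f • const (basisVec 0 * basisVec 2) ∈ LinearMap.range field2 :=
      ⟨(0, (f, 0)), by simp [field2_apply]⟩
    have h12 : f • const (basisVec 1 * basisVec 2) ∈ LinearMap.range field2 :=
      ⟨(0, (0, f)), by simp [field2_apply]⟩
    fin_cases i <;> fin_cases j <;>
      simp only [Fin.zero_eta, Fin.mk_one, Fin.reduceFinMk, basisVec_mul_self, h10, h20, h21,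
        const_zero, const_neg, smul_zero, smul_neg, neg_mem_iff, zero_mem, h01, h02, h12]
  · rintro _ ⟨P, rfl⟩
    rw [field2_apply]
    exact add_mem (add_mem (smul_const_mem_homogeneous _ (basisVec_mul_basisVec_mem _ _))
      (smul_const_mem_homogeneous _ (basisVec_mul_basisVec_mem _ _)))
      (smul_const_mem_homogeneous _ (basisVec_mul_basisVec_mem _ _))

theorem homogeneous_three_eq : homogeneous 3 3 = LinearMap.range field3 := by
  have h10 := basisVec_mul_swap (n := 3) 0 1
  have h20 := basisVec_mul_swap (n := 3) 0 2
  have h21 := basisVec_mul_swap (n := 3) 1 2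
  have h10' := fun ω => basisVec_mul_swap_mul (n := 3) ω 0 1
  have h20' := fun ω => basisVec_mul_swap_mul (n := 3) ω 0 2
  have h21' := fun ω => basisVec_mul_swap_mul (n := 3) ω 1 2
  apply le_antisymm
  · refine homogeneous_le (exteriorPower_eq_span 3 3) ?_
    intro f ω h
    rw [pow_succ', pow_two] at h
    obtain ⟨_, ⟨i, rfl⟩, _, ⟨_, ⟨j, rfl⟩, _, ⟨k, rfl⟩, rfl⟩, rfl⟩ := h
    have h012 : f • const (basisVec 0 * (basisVec 1 * basisVec 2)) ∈ LinearMap.range field3 :=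
      ⟨f, rfl⟩
    fin_cases i <;> fin_cases j <;> fin_cases k <;>
      simp only [Fin.zero_eta, Fin.mk_one, Fin.reduceFinMk, basisVec_mul_self,
        basisVec_mul_self_mul, h10, h20, h21, h10', h20', h21', mul_neg, mul_zero, neg_zero,
        const_zero, const_neg, smul_zero, smul_neg, neg_mem_iff, zero_mem, h012]
  · rintro _ ⟨t, rfl⟩
    exact smul_const_mem_homogeneous t (basisVec_mul_basisVec_mul_basisVec_mem 0 1 2)

end

end DufourHaraki

/-! ### Power series in three variables and first-order operators -/

namespace DufourHaraki

open FormalMultivector MvPowerSeries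

theorem coeff_X_mul_eq_ite (i : Fin 3) (f : Ser) (d : Fin 3 →₀ ℕ) :
    coeff d (X i * f) = if d i = 0 then 0 else coeff (d - Finsupp.single i 1) f := by
  rw [X, coeff_monomial_mul]
  simp only [Finsupp.single_le_iff, one_mul, Nat.one_le_iff_ne_zero, ite_not]

theorem coeff_X_mul_pderiv (i : Fin 3) (f : Ser) (d : Fin 3 →₀ ℕ) :
    coeff d (X i * pderiv ℝ i f) = d i * coeff d f := by
  rw [coeff_X_mul_eq_ite]
  split_ifs with h
  · simp [h]
  · have h1 : d - Finsupp.single i 1 + Finsupp.single i 1 = d :=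
      tsub_add_cancel_of_le (Finsupp.single_le_iff.2 (Nat.one_le_iff_ne_zero.2 h))
    rw [coeff_pderiv, h1, Finsupp.tsub_apply, Finsupp.single_eq_same,
      Nat.cast_pred (Nat.pos_of_ne_zero h)]
    ring

theorem pderiv_comm (i j : Fin 3) (f : Ser) :
    pderiv ℝ i (pderiv ℝ j f) = pderiv ℝ j (pderiv ℝ i f) := by
  ext d
  simp only [coeff_pderiv, Finsupp.add_apply, Finsupp.single_apply, add_right_comm d]
  by_cases h : i = j
  · subst h; rfl
  · simp [h, Ne.symm h]; ring

/-- The operator `α(x∂_x + y∂_y) + βx∂_y + γz∂_z + c` on power series. All the operators of the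
complex are built from its instances: for `β = 0` it is diagonal on monomials, and `x∂_y` only
lowers the exponent of `y` in favour of that of `x`. -/
noncomputable def op (α β γ c : ℝ) : Ser →ₗ[ℝ] Ser where
  toFun f := C α * (X 0 * pderiv ℝ 0 f + X 1 * pderiv ℝ 1 f) + C β * (X 0 * pderiv ℝ 1 f)
    + C γ * (X 2 * pderiv ℝ 2 f) + C c * f
  map_add' f g := by simp only [map_add]; ring
  map_smul' r f := by
    simp only [Derivation.map_smul]
    simp only [smul_eq_C_mul, RingHom.id_apply]
    ring

theorem op_apply (α β γ c : ℝ) (f : Ser) : op α β γ c f =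
    C α * (X 0 * pderiv ℝ 0 f + X 1 * pderiv ℝ 1 f) + C β * (X 0 * pderiv ℝ 1 f)
      + C γ * (X 2 * pderiv ℝ 2 f) + C c * f := rfl

theorem coeff_op (α β γ c : ℝ) (f : Ser) (d : Fin 3 →₀ ℕ) : coeff d (op α β γ c f) =
    (α * (d 0 + d 1 : ℕ) + γ * d 2 + c) * coeff d f +
      β * if d 0 = 0 then 0 else
        (d 1 + 1) * coeff (d - Finsupp.single 0 1 + Finsupp.single 1 1) f := by
  rw [op_apply]
  simp only [map_add, coeff_C_mul, coeff_X_mul_pderiv]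
  rw [coeff_X_mul_eq_ite]
  simp only [coeff_pderiv, Finsupp.tsub_apply]
  split_ifs <;> simp <;> ring

open Classical in
/-- The sum of the terms of a power series whose exponents satisfy `p`. -/
noncomputable def restrict (p : (Fin 3 →₀ ℕ) → Prop) : Ser →ₗ[ℝ] Ser where
  toFun f := fun d => if p d then coeff d f else 0
  map_add' f g := by
    ext d
    change (if p d then coeff d (f + g) else 0) =
      (if p d then coeff d f else 0) + (if p d then coeff d g else 0)
    split_ifs <;> simp
  map_smul' r f := by
    ext d
    change (if p d then coeff d (r • f) else 0) = r * (if p d then coeff d f else 0)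
    split_ifs <;> simp

theorem coeff_restrict_of {p : (Fin 3 →₀ ℕ) → Prop} {d : Fin 3 →₀ ℕ} (h : p d) (f : Ser) :
    coeff d (restrict p f) = coeff d f := by
  classical
  exact if_pos h

theorem coeff_restrict_of_not {p : (Fin 3 →₀ ℕ) → Prop} {d : Fin 3 →₀ ℕ} (h : ¬ p d) (f : Ser) :
    coeff d (restrict p f) = 0 := by
  classical
  exact if_neg h

/-- The operator `op α β γ c` can be inverted, by recursion on the exponent of `x`, wherever its
diagonal part does not vanish. -/
theorem exists_coeff_op_eq (α β γ c : ℝ) (g : Ser) : ∃ f : Ser, ∀ d : Fin 3 →₀ ℕ,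
    α * (d 0 + d 1 : ℕ) + γ * d 2 + c ≠ 0 → coeff d (op α β γ c f) = coeff d g := by
  let idx (i j m : ℕ) : Fin 3 →₀ ℕ :=
    Finsupp.single 0 i + Finsupp.single 1 j + Finsupp.single 2 m
  have hidx (d : Fin 3 →₀ ℕ) : idx (d 0) (d 1) (d 2) = d := by
    ext i; fin_cases i <;> simp [idx]
  -- Where the diagonal part vanishes, division by zero makes the coefficient `0`.
  let F (i : ℕ) : ℕ → ℕ → ℝ := Nat.rec
    (fun j m => coeff (idx 0 j m) g / (α * (0 + j : ℕ) + γ * m + c))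
    (fun i Fi j m => (coeff (idx (i + 1) j m) g - β * ((j + 1) * Fi (j + 1) m)) /
      (α * (i + 1 + j : ℕ) + γ * m + c)) i
  obtain ⟨f, hF⟩ : ∃ f : Ser, ∀ d, coeff d f = F (d 0) (d 1) (d 2) :=
    ⟨fun d => F (d 0) (d 1) (d 2), fun _ => rfl⟩
  have hF0 (j m : ℕ) : F 0 j m = coeff (idx 0 j m) g / (α * (0 + j : ℕ) + γ * m + c) := rfl
  have hFs (i j m : ℕ) : F (i + 1) j m =
    (coeff (idx (i + 1) j m) g - β * ((j + 1) * F i (j + 1) m)) /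
      (α * (i + 1 + j : ℕ) + γ * m + c) := rfl
  refine ⟨f, fun d hd => ?_⟩
  rw [coeff_op, hF, hF]
  cases h : d 0 with
  | zero =>
    rw [h] at hd
    have := hidx d
    rw [h] at this
    rw [hF0, this, if_pos rfl, mul_div_cancel₀ _ hd]
    ring
  | succ i =>
    rw [h] at hd
    have := hidx d
    rw [h] at this
    rw [hFs, this, if_neg (Nat.succ_ne_zero i), mul_div_cancel₀ _ hd]
    simp [h]

/-- The operator `op α β γ c` is injective wherever its diagonal part does not vanish. -/
theorem coeff_eq_zero_of_coeff_op (α β γ c : ℝ) (f : Ser)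
    (h : ∀ d : Fin 3 →₀ ℕ, α * (d 0 + d 1 : ℕ) + γ * d 2 + c ≠ 0 → coeff d (op α β γ c f) = 0)
    (d : Fin 3 →₀ ℕ) (hd : α * (d 0 + d 1 : ℕ) + γ * d 2 + c ≠ 0) : coeff d f = 0 := by
  induction hi : d 0 generalizing d with
  | zero =>
    have := h d hd
    rw [coeff_op, if_pos hi, mul_zero, add_zero] at this
    exact (mul_eq_zero.1 this).resolve_left hd
  | succ i ih =>
    have h1 := h d hd
    rw [coeff_op, if_neg (by omega), ih (d - Finsupp.single 0 1 + Finsupp.single 1 1), mul_zero,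
      mul_zero, add_zero] at h1
    · exact (mul_eq_zero.1 h1).resolve_left hd
    · have : i + (d 1 + 1) = i + 1 + d 1 := by ring
      simpa [hi, this] using hd
    · simp [hi]

theorem op_surjective {α β γ c : ℝ} (h : ∀ k m : ℕ, α * k + γ * m + c ≠ 0) (g : Ser) :
    ∃ f, op α β γ c f = g := by
  obtain ⟨f, hf⟩ := exists_coeff_op_eq α β γ c g
  exact ⟨f, MvPowerSeries.ext fun d => hf d (h _ _)⟩

theorem eq_zero_of_op_eq_zero {α β γ c : ℝ} (h : ∀ k m : ℕ, α * k + γ * m + c ≠ 0) {f : Ser}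
    (hf : op α β γ c f = 0) : f = 0 :=
  MvPowerSeries.ext fun d =>
    coeff_eq_zero_of_coeff_op α β γ c f (fun d _ => by rw [hf, map_zero]) d (h _ _)

/-! ### Homogeneous forms in `x`, `y` and the value at `z = 0` -/

/-- Power series that do not involve `z` and are homogeneous of degree `k` in `x` and `y`. -/
def IsForm (k : ℕ) (f : Ser) : Prop :=
  ∀ d : Fin 3 →₀ ℕ, ¬ (d 2 = 0 ∧ d 0 + d 1 = k) → coeff d f = 0

theorem pderiv_two_eq_zero_iff {f : Ser} :
    pderiv ℝ 2 f = 0 ↔ ∀ d : Fin 3 →₀ ℕ, d 2 ≠ 0 → coeff d f = 0 := by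
  refine ⟨fun h d hd => ?_, fun h => MvPowerSeries.ext fun d => ?_⟩
  · have := coeff_X_mul_pderiv 2 f d
    rw [h, mul_zero, map_zero] at this
    exact (mul_eq_zero.1 this.symm).resolve_left (by exact_mod_cast hd)
  · rw [coeff_pderiv, h _ (by simp), zero_mul, map_zero]

/-- The value of a power series at `z = 0`. -/
noncomputable def atZeroZ : Ser →ₗ[ℝ] Ser := restrict fun d => d 2 = 0

theorem pderiv_two_atZeroZ (f : Ser) : pderiv ℝ 2 (atZeroZ f) = 0 :=
  pderiv_two_eq_zero_iff.2 fun _ hd => coeff_restrict_of_not hd f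

theorem atZeroZ_of_pderiv_two {f : Ser} (h : pderiv ℝ 2 f = 0) : atZeroZ f = f := by
  ext d
  by_cases hd : d 2 = 0
  · exact coeff_restrict_of hd f
  · rw [pderiv_two_eq_zero_iff.1 h d hd]; exact coeff_restrict_of_not hd f

theorem atZeroZ_X_mul {i : Fin 3} (hi : i ≠ 2) (f : Ser) :
    atZeroZ (X i * f) = X i * atZeroZ f := by
  ext d
  rw [coeff_X_mul_eq_ite]
  by_cases hd : d 2 = 0
  · rw [atZeroZ, coeff_restrict_of hd, coeff_X_mul_eq_ite, coeff_restrict_of]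
    simp [hd]
  · rw [atZeroZ, coeff_restrict_of_not hd, coeff_restrict_of_not, ite_self]
    simp [hd, hi]

theorem atZeroZ_X_two_mul (f : Ser) : atZeroZ (X 2 * f) = 0 := by
  ext d
  by_cases hd : d 2 = 0
  · rw [atZeroZ, coeff_restrict_of hd, coeff_X_mul_eq_ite, if_pos hd, map_zero]
  · exact coeff_restrict_of_not hd _

theorem atZeroZ_pderiv {i : Fin 3} (hi : i ≠ 2) (f : Ser) :
    atZeroZ (pderiv ℝ i f) = pderiv ℝ i (atZeroZ f) := by
  ext d
  rw [coeff_pderiv]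
  by_cases hd : d 2 = 0
  · rw [atZeroZ, coeff_restrict_of hd, coeff_pderiv, coeff_restrict_of]
    simp [hd, hi]
  · rw [atZeroZ, coeff_restrict_of_not hd, coeff_restrict_of_not, zero_mul]
    simp [hd, hi]

theorem atZeroZ_C_mul (r : ℝ) (f : Ser) : atZeroZ (C r * f) = C r * atZeroZ f := by
  rw [← smul_eq_C_mul, map_smul, smul_eq_C_mul]

/-- The decomposition of a power series into its value at `z = 0` and a multiple of `z`. -/
theorem exists_eq_add_X_two_mul (f : Ser) :
    ∃ f₀ f₁ : Ser, pderiv ℝ 2 f₀ = 0 ∧ f = f₀ + X 2 * f₁ := by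
  have h : X 2 ∣ f - atZeroZ f := by
    rw [X_dvd_iff]
    intro d hd
    rw [map_sub, atZeroZ, coeff_restrict_of hd, sub_self]
  obtain ⟨g, hg⟩ := h
  exact ⟨atZeroZ f, g, pderiv_two_atZeroZ f, by rw [← hg]; ring⟩

theorem X_ne_zero (i : Fin 3) : (X i : Ser) ≠ 0 := by
  classical
  intro h
  simpa [coeff_X] using congrArg (coeff (Finsupp.single i 1)) h

theorem eq_zero_of_add_X_two_mul_eq_zero {f₀ f₁ : Ser} (h0 : pderiv ℝ 2 f₀ = 0)
    (h : f₀ + X 2 * f₁ = 0) : f₀ = 0 ∧ f₁ = 0 := by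
  have h1 := congrArg atZeroZ h
  rw [map_add, atZeroZ_X_two_mul, atZeroZ_of_pderiv_two h0, add_zero, map_zero] at h1
  rw [h1, zero_add] at h
  exact ⟨h1, (mul_eq_zero.1 h).resolve_left (X_ne_zero 2)⟩

theorem op_X_two_mul (α β γ c : ℝ) (f : Ser) :
    op α β γ c (X 2 * f) = X 2 * op α β γ (γ + c) f := by
  simp [op_apply, Derivation.leibniz, pderiv_X_of_ne, map_add]
  ring

theorem op_of_pderiv_two {f : Ser} (h : pderiv ℝ 2 f = 0) (α β γ γ' c : ℝ) :
    op α β γ c f = op α β γ' c f := by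
  simp [op_apply, h]

theorem pderiv_two_op {f : Ser} (h : pderiv ℝ 2 f = 0) (α β γ c : ℝ) :
    pderiv ℝ 2 (op α β γ c f) = 0 := by
  have h0 : pderiv ℝ 2 (pderiv ℝ 0 f) = 0 := by rw [pderiv_comm, h, map_zero]
  have h1 : pderiv ℝ 2 (pderiv ℝ 1 f) = 0 := by rw [pderiv_comm, h, map_zero]
  simp [op_apply, Derivation.leibniz, pderiv_X_of_ne, h, h0, h1]

theorem atZeroZ_op (α β γ c : ℝ) (f : Ser) : atZeroZ (op α β γ c f) = op α β γ c (atZeroZ f) := by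
  simp only [op_apply, map_add, atZeroZ_C_mul, atZeroZ_X_two_mul, pderiv_two_atZeroZ,
    atZeroZ_X_mul (show (0 : Fin 3) ≠ 2 by decide), atZeroZ_X_mul (show (1 : Fin 3) ≠ 2 by decide),
    atZeroZ_pderiv (show (0 : Fin 3) ≠ 2 by decide),
    atZeroZ_pderiv (show (1 : Fin 3) ≠ 2 by decide), mul_zero]

/-- On series without `z`, `a(x∂_x + y∂_y - k) - 2x∂_y` is surjective up to forms of degree `k`. -/
theorem exists_eq_op_add_form {a : ℝ} (ha : a ≠ 0) (k : ℕ) {g : Ser} (hg : pderiv ℝ 2 g = 0) :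
    ∃ f r : Ser, pderiv ℝ 2 f = 0 ∧ g = op a (-2) 0 (-(k * a)) f + r ∧ IsForm k r := by
  obtain ⟨f, hf⟩ := exists_coeff_op_eq a (-2) 0 (-(k * a)) g
  refine ⟨atZeroZ f, g - op a (-2) 0 (-(k * a)) (atZeroZ f), pderiv_two_atZeroZ f, by ring, ?_⟩
  intro d hd
  rw [map_sub, ← atZeroZ_op, ← atZeroZ_of_pderiv_two hg]
  by_cases h2 : d 2 = 0
  · rw [atZeroZ, coeff_restrict_of h2, coeff_restrict_of h2, hf, sub_self]
    intro h
    have h' : a * ((d 0 + d 1 : ℕ) - k : ℝ) = 0 := by rw [← h]; ring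
    have h'' := sub_eq_zero.1 ((mul_eq_zero.1 h').resolve_left ha)
    exact hd ⟨h2, by exact_mod_cast h''⟩
  · rw [atZeroZ, coeff_restrict_of_not h2, coeff_restrict_of_not h2, sub_self]

/-- On series without `z`, `a(x∂_x + y∂_y - k) - 2x∂_y` is injective up to forms of degree `k`. -/
theorem isForm_of_op {a : ℝ} (ha : a ≠ 0) (k : ℕ) {f : Ser} (hf : pderiv ℝ 2 f = 0)
    (h : IsForm k (op a (-2) 0 (-(k * a)) f)) : IsForm k f := by
  have key (d : Fin 3 →₀ ℕ) :
      a * (d 0 + d 1 : ℕ) + 0 * d 2 + -(k * a) ≠ 0 ↔ d 0 + d 1 ≠ k := by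
    have : a * (d 0 + d 1 : ℕ) + 0 * d 2 + -(k * a) = a * ((d 0 + d 1 : ℕ) - k : ℝ) := by ring
    rw [this, mul_ne_zero_iff, sub_ne_zero]
    exact (and_iff_right ha).trans (not_congr Nat.cast_inj)
  intro d hd
  by_cases h2 : d 2 = 0
  · refine coeff_eq_zero_of_coeff_op a (-2) 0 (-(k * a)) f (fun d hd => h d ?_) d ?_
    · exact fun h => (key d).1 hd h.2
    · exact (key d).2 fun h => hd ⟨h2, h⟩
  · exact pderiv_two_eq_zero_iff.1 hf d h2

/-! ### Constants, linear and quadratic forms -/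

theorem exponent_eq_iff (d : Fin 3 →₀ ℕ) (i j m : ℕ) :
    d = Finsupp.single 0 i + Finsupp.single 1 j + Finsupp.single 2 m ↔
      d 0 = i ∧ d 1 = j ∧ d 2 = m := by
  refine ⟨fun h => by simp [h], fun ⟨h0, h1, h2⟩ => ?_⟩
  ext i; fin_cases i <;> simp [h0, h1, h2]

theorem monomial_eq (i j m : ℕ) :
    (X 0 ^ i * X 1 ^ j * X 2 ^ m : Ser) = monomial
      (Finsupp.single 0 i + Finsupp.single 1 j + Finsupp.single 2 m) 1 := by
  simp [X_pow_eq, monomial_mul_monomial]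

theorem coeff_monomial_eq (i j m : ℕ) (d : Fin 3 →₀ ℕ) :
    coeff d (X 0 ^ i * X 1 ^ j * X 2 ^ m : Ser) = if d 0 = i ∧ d 1 = j ∧ d 2 = m then 1 else 0 := by
  classical
  rw [monomial_eq, coeff_monomial]
  exact if_congr (exponent_eq_iff d i j m) rfl rfl

theorem IsForm.eq_C {f : Ser} (h : IsForm 0 f) : ∃ r, f = C r := by
  classical
  refine ⟨coeff 0 f, MvPowerSeries.ext fun d => ?_⟩
  rw [coeff_C]
  split_ifs with hd
  · rw [hd]
  · refine h d fun ⟨h2, h01⟩ => hd ?_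
    ext i; fin_cases i <;> simp <;> omega

theorem IsForm.eq_linear {f : Ser} (h : IsForm 1 f) :
    ∃ p q, f = C p * X 0 + C q * X 1 := by
  refine ⟨coeff (Finsupp.single 0 1 + Finsupp.single 1 0 + Finsupp.single 2 0) f,
    coeff (Finsupp.single 0 0 + Finsupp.single 1 1 + Finsupp.single 2 0) f,
    MvPowerSeries.ext fun d => ?_⟩
  have h0 := coeff_monomial_eq 1 0 0 d
  have h1 := coeff_monomial_eq 0 1 0 d
  simp only [pow_zero, pow_one, mul_one, one_mul] at h0 h1
  rw [map_add, coeff_C_mul, coeff_C_mul, h0, h1]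
  by_cases hd : d 2 = 0 ∧ d 0 + d 1 = 1
  · obtain h | h : d 0 = 1 ∧ d 1 = 0 ∨ d 0 = 0 ∧ d 1 = 1 := by omega
    · rw [← (exponent_eq_iff d 1 0 0).2 ⟨h.1, h.2, hd.1⟩]; simp [h, hd]
    · rw [← (exponent_eq_iff d 0 1 0).2 ⟨h.1, h.2, hd.1⟩]; simp [h, hd]
  · rw [h d hd, if_neg (by omega), if_neg (by omega)]; simp

theorem IsForm.eq_quadratic {f : Ser} (h : IsForm 2 f) :
    ∃ p q r, f = C p * X 0 ^ 2 + C q * (X 0 * X 1) + C r * X 1 ^ 2 := by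
  refine ⟨coeff (Finsupp.single 0 2 + Finsupp.single 1 0 + Finsupp.single 2 0) f,
    coeff (Finsupp.single 0 1 + Finsupp.single 1 1 + Finsupp.single 2 0) f,
    coeff (Finsupp.single 0 0 + Finsupp.single 1 2 + Finsupp.single 2 0) f,
    MvPowerSeries.ext fun d => ?_⟩
  have h0 := coeff_monomial_eq 2 0 0 d
  have h1 := coeff_monomial_eq 1 1 0 d
  have h2 := coeff_monomial_eq 0 2 0 d
  simp only [pow_zero, pow_one, mul_one, one_mul] at h0 h1 h2
  rw [map_add, map_add, coeff_C_mul, coeff_C_mul, coeff_C_mul, h0, h1, h2]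
  by_cases hd : d 2 = 0 ∧ d 0 + d 1 = 2
  · obtain h | h | h : d 0 = 2 ∧ d 1 = 0 ∨ d 0 = 1 ∧ d 1 = 1 ∨ d 0 = 0 ∧ d 1 = 2 := by omega
    · rw [← (exponent_eq_iff d 2 0 0).2 ⟨h.1, h.2, hd.1⟩]; simp [h, hd]
    · rw [← (exponent_eq_iff d 1 1 0).2 ⟨h.1, h.2, hd.1⟩]; simp [h, hd]
    · rw [← (exponent_eq_iff d 0 2 0).2 ⟨h.1, h.2, hd.1⟩]; simp [h, hd]
  · rw [h d hd, if_neg (by omega), if_neg (by omega), if_neg (by omega)]; simp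

theorem eq_zero_of_linear_eq_zero {p q : ℝ} (h : (C p * X 0 + C q * X 1 : Ser) = 0) :
    p = 0 ∧ q = 0 := by
  have h0 d := coeff_monomial_eq 1 0 0 d
  have h1 d := coeff_monomial_eq 0 1 0 d
  simp only [pow_zero, pow_one, mul_one, one_mul] at h0 h1
  constructor
  · simpa [h0, h1] using congrArg (coeff (Finsupp.single 0 1)) h
  · simpa [h0, h1] using congrArg (coeff (Finsupp.single 1 1)) h

theorem eq_zero_of_quadratic_eq_zero {p q r : ℝ}
    (h : (C p * X 0 ^ 2 + C q * (X 0 * X 1) + C r * X 1 ^ 2 : Ser) = 0) :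
    p = 0 ∧ q = 0 ∧ r = 0 := by
  have h0 d := coeff_monomial_eq 2 0 0 d
  have h1 d := coeff_monomial_eq 1 1 0 d
  have h2 d := coeff_monomial_eq 0 2 0 d
  simp only [pow_zero, pow_one, mul_one, one_mul] at h0 h1 h2
  refine ⟨?_, ?_, ?_⟩
  · simpa [h0, h1, h2] using congrArg (coeff (Finsupp.single 0 2)) h
  · have hd := congrArg (coeff (Finsupp.single 0 1 + Finsupp.single 1 1)) h
    simp only [map_add, coeff_C_mul, h0, h1, h2, Finsupp.add_apply] at hd
    simpa using hd
  · simpa [h0, h1, h2] using congrArg (coeff (Finsupp.single 1 2)) h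

theorem isForm_one_linear (p q : ℝ) : IsForm 1 (C p * X 0 + C q * X 1) := by
  intro d hd
  have h0 := coeff_monomial_eq 1 0 0 d
  have h1 := coeff_monomial_eq 0 1 0 d
  simp only [pow_zero, pow_one, mul_one, one_mul] at h0 h1
  rw [map_add, coeff_C_mul, coeff_C_mul, h0, h1, if_neg (by omega), if_neg (by omega)]; simp

theorem isForm_two_quadratic (p q r : ℝ) :
    IsForm 2 (C p * X 0 ^ 2 + C q * (X 0 * X 1) + C r * X 1 ^ 2) := by
  intro d hd
  have h0 := coeff_monomial_eq 2 0 0 d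
  have h1 := coeff_monomial_eq 1 1 0 d
  have h2 := coeff_monomial_eq 0 2 0 d
  simp only [pow_zero, pow_one, mul_one, one_mul] at h0 h1 h2
  rw [map_add, map_add, coeff_C_mul, coeff_C_mul, coeff_C_mul, h0, h1, h2, if_neg (by omega),
    if_neg (by omega), if_neg (by omega)]
  simp

/-! ### Divisibility by the coordinates -/

theorem X_zero_dvd_of_dvd_X_one_mul {f : Ser} (h : X 0 ∣ X 1 * f) : X 0 ∣ f := by
  rw [X_dvd_iff] at h ⊢
  intro d hd
  have := h (d + Finsupp.single 1 1) (by simp [hd])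
  rwa [coeff_X_mul_eq_ite, if_neg (by simp), add_tsub_cancel_right] at this

/-- Every power series is a series in `z` alone plus multiples of `x` and of `y`. -/
theorem exists_eq_add_X_mul_add_X_mul (g : Ser) : ∃ u g₀ g₁ : Ser,
    pderiv ℝ 0 u = 0 ∧ pderiv ℝ 1 u = 0 ∧ g = u + X 0 * g₀ + X 1 * g₁ := by
  set u := restrict (fun d => d 0 = 0 ∧ d 1 = 0) g with hu
  set v := restrict (fun d => d 0 = 0 ∧ d 1 ≠ 0) g with hv
  have h0 : X 0 ∣ g - u - v := by
    rw [X_dvd_iff]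
    intro d hd
    by_cases h1 : d 1 = 0
    · rw [map_sub, map_sub, hu, hv, coeff_restrict_of (by exact ⟨hd, h1⟩),
        coeff_restrict_of_not (by exact fun h => h.2 h1)]
      ring
    · rw [map_sub, map_sub, hu, hv, coeff_restrict_of_not (by exact fun h => h1 h.2),
        coeff_restrict_of (by exact ⟨hd, h1⟩)]
      ring
  have h1 : X 1 ∣ v := by
    rw [X_dvd_iff]
    intro d hd
    exact coeff_restrict_of_not (by exact fun h => h.2 hd) g
  obtain ⟨g₀, h0⟩ := h0
  obtain ⟨g₁, h1⟩ := h1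
  refine ⟨u, g₀, g₁, ?_, ?_, by rw [← h0, ← h1]; ring⟩
  all_goals
    ext d
    rw [coeff_pderiv, hu, coeff_restrict_of_not (by simp), zero_mul, map_zero]

end DufourHaraki

/-! ### The planar complex -/

namespace DufourHaraki

open FormalMultivector MvPowerSeries

/-- The differential of the planar complex on functions, `f ↦ [x²∂₁₂, f] - M(f) W`, in the
components along `∂₁`, `∂₂`. Here `W = a Y₁ - 2 Y₂ = ax∂₁ + (ay - 2x)∂₂` and `M = γ z∂_z + c`. For a
function with a factor `zᵐ`, where `M` is multiplication by `m`, this is the planar part of `[Λ₃, f]`.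
The parameters `γ`, `c` allow factors `z` and `∂₃` to be split off. -/
noncomputable def planar0 (a γ c : ℝ) : Ser →ₗ[ℝ] Ser × Ser where
  toFun f := (X 0 * op 0 1 (-a * γ) (-a * c) f,
    X 1 * op 0 1 (-a * γ) (-a * c) f + X 0 * op (-1) 0 (2 * γ) (2 * c) f)
  map_add' f g := by simp only [map_add, Prod.mk_add_mk, Prod.mk.injEq]; constructor <;> ring
  map_smul' r f := by
    simp only [map_smul]
    simp only [smul_eq_C_mul, RingHom.id_apply, Prod.smul_mk, Prod.mk.injEq]
    constructor <;> ring

/-- The differential of the planar complex on vector fields `A = A₁∂₁ + A₂∂₂`, namely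
`A ↦ [x²∂₁₂, A] - M(W ∧ A)`, as the coefficient of `∂₁₂`, with `W` and `M` as for `planar0`. -/
noncomputable def planar1 (a γ c : ℝ) : Ser × Ser →ₗ[ℝ] Ser where
  toFun A := X 0 ^ 2 * (pderiv ℝ 0 A.1 + pderiv ℝ 1 A.2) - 2 * X 0 * A.1
    - op 0 0 γ c (C a * X 0 * A.2 - (C a * X 1 - 2 * X 0) * A.1)
  map_add' A B := by
    simp only [Prod.fst_add, Prod.snd_add, map_add, mul_add, map_sub]; ring
  map_smul' r A := by
    rw [show C a * X 0 * (r • A).2 - (C a * X 1 - 2 * X 0) * (r • A).1 =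
      r • (C a * X 0 * A.2 - (C a * X 1 - 2 * X 0) * A.1) by
        simp only [Prod.smul_fst, Prod.smul_snd, smul_eq_C_mul]; ring, map_smul]
    simp only [Prod.smul_fst, Prod.smul_snd, Derivation.map_smul]
    simp only [smul_eq_C_mul, RingHom.id_apply]; ring

/-- The Lie derivative of functions along `W = a Y₁ - 2 Y₂`. -/
noncomputable def lie0 (a : ℝ) : Ser →ₗ[ℝ] Ser := op a (-2) 0 0

/-- The Lie derivative of planar vector fields along `W = a Y₁ - 2 Y₂`. -/
noncomputable def lie1 (a : ℝ) : Ser × Ser →ₗ[ℝ] Ser × Ser where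
  toFun A := (op a (-2) 0 (-a) A.1, op a (-2) 0 (-a) A.2 + 2 * A.1)
  map_add' A B := by
    simp only [Prod.fst_add, Prod.snd_add, map_add, mul_add, Prod.mk_add_mk, Prod.mk.injEq,
      true_and]
    ring
  map_smul' r A := by
    simp only [Prod.smul_fst, Prod.smul_snd, map_smul]
    simp only [smul_eq_C_mul, RingHom.id_apply, Prod.smul_mk, Prod.mk.injEq, true_and]
    ring

/-- The Lie derivative of planar bivector fields along `W = a Y₁ - 2 Y₂`. -/
noncomputable def lie2 (a : ℝ) : Ser →ₗ[ℝ] Ser := op a (-2) 0 (-2 * a)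

theorem planar0_apply (a γ c : ℝ) (f : Ser) : planar0 a γ c f =
    (X 0 * op 0 1 (-a * γ) (-a * c) f,
      X 1 * op 0 1 (-a * γ) (-a * c) f + X 0 * op (-1) 0 (2 * γ) (2 * c) f) := rfl

theorem planar1_apply (a γ c : ℝ) (A : Ser × Ser) : planar1 a γ c A =
    X 0 ^ 2 * (pderiv ℝ 0 A.1 + pderiv ℝ 1 A.2) - 2 * X 0 * A.1
      - op 0 0 γ c (C a * X 0 * A.2 - (C a * X 1 - 2 * X 0) * A.1) := rfl

theorem lie0_apply (a : ℝ) (f : Ser) : lie0 a f = op a (-2) 0 0 f := rfl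

theorem lie1_apply (a : ℝ) (A : Ser × Ser) :
    lie1 a A = (op a (-2) 0 (-a) A.1, op a (-2) 0 (-a) A.2 + 2 * A.1) := rfl

theorem lie2_apply (a : ℝ) (f : Ser) : lie2 a f = op a (-2) 0 (-2 * a) f := rfl

theorem C_two : (C 2 : Ser) = 2 := map_ofNat C 2

theorem pderiv_ofNat_two (i : Fin 3) : pderiv ℝ i (2 : Ser) = 0 := by
  rw [← C_two, pderiv_C]

theorem planar1_planar0 (a γ c : ℝ) (f : Ser) : planar1 a γ c (planar0 a γ c f) = 0 := by
  have h10 := pderiv_comm 1 0 f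
  have h20 := pderiv_comm 2 0 f
  have h21 := pderiv_comm 2 1 f
  simp [planar0_apply, planar1_apply, op_apply, Derivation.leibniz, pderiv_X_of_ne, C_two,
    pderiv_ofNat_two, h10, h20, h21]
  ring

/-- The Lie derivative along `W` commutes with the planar differential, as `W` commutes with `Y₁`
and `Y₂`, hence preserves `x²∂₁₂ = Y₁ ∧ Y₂`. -/
theorem lie1_planar0 (a γ c : ℝ) (f : Ser) :
    lie1 a (planar0 a γ c f) = planar0 a γ c (lie0 a f) := by
  have h10 := pderiv_comm 1 0 f
  have h20 := pderiv_comm 2 0 f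
  have h21 := pderiv_comm 2 1 f
  simp [planar0_apply, lie0_apply, lie1_apply, op_apply, Derivation.leibniz, pderiv_X_of_ne, C_two,
    pderiv_ofNat_two, h10, h20, h21]
  constructor <;> ring

theorem lie2_planar1 (a γ c : ℝ) (A : Ser × Ser) :
    lie2 a (planar1 a γ c A) = planar1 a γ c (lie1 a A) := by
  have h10 f := pderiv_comm 1 0 f
  have h20 f := pderiv_comm 2 0 f
  have h21 f := pderiv_comm 2 1 f
  simp [planar1_apply, lie2_apply, lie1_apply, op_apply, Derivation.leibniz, pderiv_X_of_ne, C_two,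
    pderiv_ofNat_two, h10, h20, h21]
  ring

theorem planar0_X_two_mul (a γ c : ℝ) (f : Ser) :
    planar0 a γ c (X 2 * f) = (X 2 : Ser) • planar0 a γ (γ + c) f := by
  simp only [planar0_apply, op_X_two_mul, Prod.smul_mk, smul_eq_mul, Prod.mk.injEq, mul_add]
  constructor <;> ring

theorem planar1_X_two_smul (a γ c : ℝ) (A : Ser × Ser) :
    planar1 a γ c ((X 2 : Ser) • A) = X 2 * planar1 a γ (γ + c) A := by
  simp [planar1_apply, op_apply, Derivation.leibniz, pderiv_X_of_ne, pderiv_ofNat_two]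
  ring

theorem lie0_X_two_mul (a : ℝ) (f : Ser) : lie0 a (X 2 * f) = X 2 * lie0 a f := by
  rw [lie0_apply, op_X_two_mul, zero_add, lie0_apply]

theorem lie2_X_two_mul (a : ℝ) (f : Ser) : lie2 a (X 2 * f) = X 2 * lie2 a f := by
  rw [lie2_apply, op_X_two_mul, zero_add, lie2_apply]

theorem lie1_X_two_smul (a : ℝ) (A : Ser × Ser) :
    lie1 a ((X 2 : Ser) • A) = (X 2 : Ser) • lie1 a A := by
  simp only [lie1_apply, Prod.smul_fst, Prod.smul_snd, smul_eq_mul, op_X_two_mul, zero_add,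
    Prod.smul_mk, Prod.mk.injEq, true_and]
  ring

theorem planar0_of_pderiv_two {f : Ser} (h : pderiv ℝ 2 f = 0) (a γ γ' c : ℝ) :
    planar0 a γ c f = planar0 a γ' c f := by
  rw [planar0_apply, planar0_apply, op_of_pderiv_two h 0 1 _ (-a * γ'),
    op_of_pderiv_two h (-1) 0 _ (2 * γ')]

theorem planar1_of_pderiv_two {A : Ser × Ser} (h1 : pderiv ℝ 2 A.1 = 0)
    (h2 : pderiv ℝ 2 A.2 = 0) (a γ γ' c : ℝ) : planar1 a γ c A = planar1 a γ' c A := by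
  simp [planar1_apply, op_apply, Derivation.leibniz, pderiv_X_of_ne, pderiv_ofNat_two, h1, h2]

/-! ### Cohomology of the planar complex for invertible `M`

For `M = γ z∂_z + c` with no zero eigenvalue, the planar complex is exact except in degree `2`,
where the cohomology consists of the series in `z` alone. -/

section Invertible

variable {a γ c : ℝ}

theorem eq_zero_of_planar0_eq_zero (ha : a ≠ 0) (h : ∀ m : ℕ, γ * m + c ≠ 0) {f : Ser}
    (hf : planar0 a γ c f = 0) : f = 0 := by
  rw [planar0_apply, Prod.mk_eq_zero] at hf
  refine eq_zero_of_op_eq_zero ?_ ((mul_eq_zero.1 hf.1).resolve_left (X_ne_zero 0))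
  intro k m
  have : 0 * (k : ℝ) + -a * γ * m + -a * c = -a * (γ * m + c) := by ring
  rw [this]
  exact mul_ne_zero (neg_ne_zero.2 ha) (h m)

theorem exists_planar0_eq (ha : a ≠ 0) (h : ∀ m : ℕ, γ * m + c ≠ 0) {A : Ser × Ser}
    (hA : planar1 a γ c A = 0) : ∃ f, planar0 a γ c f = A := by
  have hM : ∀ k m : ℕ, 0 * (k : ℝ) + γ * m + c ≠ 0 := fun k m => by
    rw [zero_mul, zero_add]; exact h m
  have hN : ∀ k m : ℕ, 0 * (k : ℝ) + -a * γ * m + -a * c ≠ 0 := fun k m => by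
    have : 0 * (k : ℝ) + -a * γ * m + -a * c = -a * (γ * m + c) := by ring
    rw [this]
    exact mul_ne_zero (neg_ne_zero.2 ha) (h m)
  -- Modulo `x`, the cocycle condition reads `a y M(A.1) = 0`, so `x` divides `A.1`.
  have hd : X 0 ∣ X 1 * (C a * op 0 0 γ c A.1) := by
    refine ⟨-(X 0 * (pderiv ℝ 0 A.1 + pderiv ℝ 1 A.2) - 2 * A.1
      - op 0 0 γ c (C a * A.2 + 2 * A.1)), ?_⟩
    rw [← sub_eq_zero, ← hA]
    simp [planar1_apply, op_apply, Derivation.leibniz, pderiv_X_of_ne, pderiv_ofNat_two]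
    ring
  obtain ⟨k, hk⟩ := X_zero_dvd_of_dvd_X_one_mul hd
  obtain ⟨h₀, rfl⟩ := op_surjective (β := 0) hM k
  have hA1 : A.1 = X 0 * (C a⁻¹ * h₀) := by
    refine sub_eq_zero.1 (eq_zero_of_op_eq_zero (β := 0) hM ?_)
    have : C a⁻¹ * C a = (1 : Ser) := by rw [← map_mul, inv_mul_cancel₀ ha, map_one]
    have h1 : op 0 0 γ c A.1 = X 0 * (C a⁻¹ * op 0 0 γ c h₀) := by
      linear_combination C a⁻¹ * hk - op 0 0 γ c A.1 * this
    rw [map_sub, h1]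
    simp [op_apply, Derivation.leibniz, pderiv_X_of_ne]
    ring
  -- The first component determines a primitive, and the second one then follows.
  obtain ⟨f, hf⟩ := op_surjective (β := 1) hN (C a⁻¹ * h₀)
  refine ⟨f, ?_⟩
  have h1 : (A - planar0 a γ c f).1 = 0 := by
    rw [Prod.fst_sub, hA1, planar0_apply, hf, sub_self]
  have h2 : planar1 a γ c (A - planar0 a γ c f) = 0 := by
    rw [map_sub, hA, planar1_planar0, sub_self]
  have h3 : (A - planar0 a γ c f).2 = 0 := by
    refine eq_zero_of_op_eq_zero (β := 1) hN ((mul_eq_zero.1 ?_).resolve_left (X_ne_zero 0))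
    rw [← h2]
    generalize A - planar0 a γ c f = B at h1
    simp [planar1_apply, op_apply, Derivation.leibniz, pderiv_X_of_ne, h1]
    ring
  exact (sub_eq_zero.1 (Prod.ext h1 h3)).symm

theorem exists_eq_planar1_add (ha : a ≠ 0) (h : ∀ m : ℕ, γ * m + c ≠ 0) (g : Ser) :
    ∃ A u, g = planar1 a γ c A + u ∧ pderiv ℝ 0 u = 0 ∧ pderiv ℝ 1 u = 0 := by
  have hM : ∀ k m : ℕ, 0 * (k : ℝ) + γ * m + c ≠ 0 := fun k m => by
    rw [zero_mul, zero_add]; exact h m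
  have hN : ∀ k m : ℕ, 0 * (k : ℝ) + -a * γ * m + -a * c ≠ 0 := fun k m => by
    have : 0 * (k : ℝ) + -a * γ * m + -a * c = -a * (γ * m + c) := by ring
    rw [this]
    exact mul_ne_zero (neg_ne_zero.2 ha) (h m)
  obtain ⟨u, g₀, g₁, hu0, hu1, rfl⟩ := exists_eq_add_X_mul_add_X_mul g
  -- `A₁` accounts for `g` modulo `x`, and `A₂` for the remaining multiple of `x`.
  obtain ⟨A₁, hA₁⟩ := op_surjective (β := 0) hM (C a⁻¹ * g₁)
  obtain ⟨A₂, hA₂⟩ := op_surjective (β := 1) hN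
    (g₀ - X 0 * pderiv ℝ 0 A₁ + 2 * A₁ + 2 * (C a⁻¹ * g₁))
  refine ⟨(A₁, A₂), u, ?_, hu0, hu1⟩
  have hinv : C a * C a⁻¹ = (1 : Ser) := by rw [← map_mul, mul_inv_cancel₀ ha, map_one]
  have e : planar1 a γ c (A₁, A₂) = X 0 * (X 0 * pderiv ℝ 0 A₁ - 2 * A₁
      + op 0 1 (-a * γ) (-a * c) A₂) + (C a * X 1 - 2 * X 0) * op 0 0 γ c A₁ := by
    simp [planar1_apply, op_apply, Derivation.leibniz, pderiv_X_of_ne, pderiv_ofNat_two]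
    ring
  rw [e, hA₁, hA₂]
  linear_combination -(X 1 * g₁) * hinv

end Invertible

/-! ### The Lichnerowicz–Poisson complex in components -/

/-- The differential of the complex from degree `0` to degree `1`, in the components of `field0` and
`field1`. -/
noncomputable def diff0 (a : ℝ) (f : Ser) : (Ser × Ser) × Ser :=
  (planar0 a 1 0 f, X 2 * lie0 a f)

/-- The differential of the complex from degree `1` to degree `2`, in the components of `field1` and
`field2`. The coefficient of `∂₃` has weight one less in `z`, whence `M = z∂_z - 1`. -/
noncomputable def diff1 (a : ℝ) (P : (Ser × Ser) × Ser) : Ser × (Ser × Ser) :=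
  (planar1 a 1 0 P.1, planar0 a 1 (-1) P.2 - (X 2 : Ser) • lie1 a P.1)

/-- The differential of the complex from degree `2` to degree `3`, in the components of `field2` and
`field3`. -/
noncomputable def diff2 (a : ℝ) (S : Ser × (Ser × Ser)) : Ser :=
  planar1 a 1 (-1) S.2 + X 2 * lie2 a S.1

theorem Y1_eq : Y1 = (X 0 : Ser) • const (basisVec 0) + (X 1 : Ser) • const (basisVec 1) := rfl

theorem Y2_eq : Y2 = (X 0 : Ser) • const (basisVec 1) := rfl

theorem Y3_eq : Y3 = (X 2 : Ser) • const (basisVec 2) := rfl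

theorem Y1_eq_field1 : Y1 = field1 ((X 0, X 1), 0) := by
  simp [Y1_eq, field1_apply]

theorem Y2_eq_field1 : Y2 = field1 ((0, X 0), 0) := by
  simp [Y2_eq, field1_apply]

theorem Y3_eq_field1 : Y3 = field1 ((0, 0), X 2) := by
  simp [Y3_eq, field1_apply]

theorem Y2_mul_Y3 : Y2 * Y3 = field2 (0, (0, X 0 * X 2)) := by
  simp [Y2_eq, Y3_eq, field2_apply, smul_const_mul_smul_const]

theorem Y3_mul_Y1 : Y3 * Y1 = field2 (0, (-(X 0 * X 2), -(X 1 * X 2))) := by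
  have h20 := basisVec_mul_swap (n := 3) 0 2
  have h21 := basisVec_mul_swap (n := 3) 1 2
  simp [Y1_eq, Y3_eq, field2_apply, smul_const_mul_smul_const, mul_add, h20, h21, const_neg,
    mul_comm (X 2 : Ser)]

theorem Y1_mul_Y2 : Y1 * Y2 = field2 (X 0 ^ 2, (0, 0)) := by
  simp [Y1_eq, Y2_eq, field2_apply, smul_const_mul_smul_const, add_mul, basisVec_mul_self,
    const_zero, pow_two]

theorem two_smul_yz_add_y_sq_eq : (2 : ℝ) • (y * z * (d3 * d1)) + y ^ 2 * (d1 * d2) =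
    field2 (X 1 ^ 2, (-(2 * (X 1 * X 2)), 0)) := by
  have h20 := basisVec_mul_swap (n := 3) 0 2
  have h1 : y * z * (d3 * d1) = field2 (0, (-(X 1 * X 2), 0)) := by
    have e1 : y * z = (X 1 * X 2 : Ser) • const 1 := by
      rw [y, z, ofSeries_eq, ofSeries_eq, smul_const_mul_smul_const, mul_one]
    have e2 : d3 * d1 = (1 : Ser) • const (basisVec 2 * basisVec 0) := by
      rw [← one_mul (1 : Ser), ← smul_const_mul_smul_const, one_smul, one_smul]; rfl
    rw [e1, e2, smul_const_mul_smul_const, h20]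
    simp [field2_apply, const_neg]
  have h2 : y ^ 2 * (d1 * d2) = field2 (X 1 ^ 2, (0, 0)) := by
    have e1 : y ^ 2 = (X 1 ^ 2 : Ser) • const 1 := by
      rw [pow_two, y, ofSeries_eq, smul_const_mul_smul_const, mul_one, pow_two]
    have e2 : d1 * d2 = (1 : Ser) • const (basisVec 0 * basisVec 1) := by
      rw [← one_mul (1 : Ser), ← smul_const_mul_smul_const, one_smul, one_smul]; rfl
    rw [e1, e2, smul_const_mul_smul_const]
    simp [field2_apply]
  rw [h1, h2, ← map_smul, ← map_add]
  congr 1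
  simp [smul_eq_C_mul, C_two]

theorem d1_mul_d2_mul_d3 : d1 * d2 * d3 = field3 1 := by
  have h (i : Fin 3) : coordField i = (1 : Ser) • const (basisVec i) := by rw [one_smul]; rfl
  rw [d1, d2, d3, h, h, h, smul_const_mul_smul_const, smul_const_mul_smul_const, field3_apply,
    mul_assoc (basisVec 0), one_mul, one_mul]

theorem y_sq_mul_z_mul : y ^ 2 * z * (d1 * d2 * d3) = field3 (X 1 ^ 2 * X 2) := by
  have e : y ^ 2 * z = (X 1 ^ 2 * X 2 : Ser) • const 1 := by
    rw [pow_two, y, z, ofSeries_eq, ofSeries_eq, smul_const_mul_smul_const,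
      smul_const_mul_smul_const, mul_one, mul_one, pow_two]
  rw [e, d1_mul_d2_mul_d3, field3_apply, smul_const_mul_smul_const, one_mul, mul_one, field3_apply]

theorem one_eq_field0 : (1 : FormalMultivector 3) = field0 1 := by
  rw [field0_apply, one_smul]; rfl

theorem Λ3_eq (a : ℝ) : Λ3 a =
    field2 (X 0 ^ 2, (-(C a * X 0 * X 2), (2 * X 0 - C a * X 1) * X 2)) := by
  rw [Λ3, Y2_mul_Y3, Y3_mul_Y1, Y1_mul_Y2, ← map_smul, ← map_smul, ← map_add, ← map_add]
  congr 1
  simp [smul_eq_C_mul, C_two]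
  constructor <;> ring

theorem schouten_Λ3_field0 (a : ℝ) (f : Ser) :
    schouten (Λ3 a) (field0 f) = field1 (diff0 a f) := by
  rw [Λ3_eq, schouten_field2_field0]
  congr 1
  simp [diff0, planar0_apply, lie0_apply, op_apply, C_two]
  refine ⟨⟨?_, ?_⟩, ?_⟩ <;> ring

theorem schouten_Λ3_field1 (a : ℝ) (P : (Ser × Ser) × Ser) :
    schouten (Λ3 a) (field1 P) = field2 (diff1 a P) := by
  obtain ⟨⟨P₁, P₂⟩, P₃⟩ := P
  rw [Λ3_eq, schouten_field2_field1]
  congr 1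
  simp [diff1, planar0_apply, planar1_apply, lie1_apply, op_apply, C_two, Derivation.leibniz,
    pderiv_X_of_ne, pderiv_ofNat_two]
  refine ⟨?_, ?_, ?_⟩ <;> ring

theorem schouten_Λ3_field2 (a : ℝ) (S : Ser × (Ser × Ser)) :
    schouten (Λ3 a) (field2 S) = field3 (diff2 a S) := by
  obtain ⟨g, B₁, B₂⟩ := S
  rw [Λ3_eq, schouten_field2_field2]
  congr 1
  simp [diff2, planar1_apply, lie2_apply, op_apply, C_two, Derivation.leibniz,
    pderiv_X_of_ne, pderiv_ofNat_two]
  ring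

theorem diff1_diff0 (a : ℝ) (f : Ser) : diff1 a (diff0 a f) = 0 := by
  simp only [diff0, diff1, planar1_planar0, planar0_X_two_mul, lie1_planar0]
  norm_num

theorem diff2_diff1 (a : ℝ) (P : (Ser × Ser) × Ser) : diff2 a (diff1 a P) = 0 := by
  simp only [diff1, diff2, map_sub, planar1_planar0, planar1_X_two_smul, lie2_planar1]
  norm_num

end DufourHaraki

/-! ### Splitting off the value at `z = 0` -/

namespace DufourHaraki

open FormalMultivector MvPowerSeries

/-- A pair of power series that do not involve `z`. -/
def ZFree (A : Ser × Ser) : Prop := pderiv ℝ 2 A.1 = 0 ∧ pderiv ℝ 2 A.2 = 0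

theorem ZFree.sub {A B : Ser × Ser} (hA : ZFree A) (hB : ZFree B) : ZFree (A - B) :=
  ⟨by rw [Prod.fst_sub, map_sub, hA.1, hB.1, sub_zero],
    by rw [Prod.snd_sub, map_sub, hA.2, hB.2, sub_zero]⟩

theorem exists_eq_add_X_two_smul (A : Ser × Ser) :
    ∃ A₀ A₁ : Ser × Ser, ZFree A₀ ∧ A = A₀ + (X 2 : Ser) • A₁ := by
  obtain ⟨f₀, f₁, hf, h⟩ := exists_eq_add_X_two_mul A.1
  obtain ⟨g₀, g₁, hg, h'⟩ := exists_eq_add_X_two_mul A.2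
  exact ⟨(f₀, g₀), (f₁, g₁), ⟨hf, hg⟩, Prod.ext h h'⟩

theorem eq_zero_of_add_X_two_smul_eq_zero {A₀ A₁ : Ser × Ser} (h0 : ZFree A₀)
    (h : A₀ + (X 2 : Ser) • A₁ = 0) : A₀ = 0 ∧ A₁ = 0 := by
  have h1 := eq_zero_of_add_X_two_mul_eq_zero h0.1 (Prod.ext_iff.1 h).1
  have h2 := eq_zero_of_add_X_two_mul_eq_zero h0.2 (Prod.ext_iff.1 h).2
  exact ⟨Prod.ext h1.1 h2.1, Prod.ext h1.2 h2.2⟩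

theorem zFree_planar0 {f : Ser} (h : pderiv ℝ 2 f = 0) (a γ c : ℝ) : ZFree (planar0 a γ c f) := by
  constructor <;>
    simp [planar0_apply, Derivation.leibniz, pderiv_X_of_ne, pderiv_two_op h]

theorem pderiv_two_planar1 {A : Ser × Ser} (h : ZFree A) (a γ c : ℝ) :
    pderiv ℝ 2 (planar1 a γ c A) = 0 := by
  have h0 : pderiv ℝ 2 (pderiv ℝ 0 A.1) = 0 := by rw [pderiv_comm, h.1, map_zero]
  have h1 : pderiv ℝ 2 (pderiv ℝ 1 A.2) = 0 := by rw [pderiv_comm, h.2, map_zero]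
  rw [planar1_apply, map_sub, pderiv_two_op, sub_zero]
  all_goals
    simp [Derivation.leibniz, pderiv_X_of_ne, pderiv_ofNat_two, h.1, h.2, h0, h1]

theorem zFree_lie1 {A : Ser × Ser} (h : ZFree A) (a : ℝ) : ZFree (lie1 a A) := by
  constructor
  · rw [lie1_apply]; exact pderiv_two_op h.1 _ _ _ _
  · rw [lie1_apply, map_add, pderiv_two_op h.2]
    simp [Derivation.leibniz, pderiv_ofNat_two, h.1]

theorem pderiv_two_lie2 {g : Ser} (h : pderiv ℝ 2 g = 0) (a : ℝ) : pderiv ℝ 2 (lie2 a g) = 0 :=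
  pderiv_two_op h _ _ _ _

/-! ### The part of weight zero in `z`

A cocycle of weight zero can be made invariant under `W`, since the Lie derivative along `W` is
homotopic to zero; it is then given by forms of fixed degree in `x` and `y`. -/

section Zero

variable {a : ℝ}

/-- Degree `1` of the cone for `M = 0`: the classes of `Y₁`, `Y₂` and `Y₃`. The parameters `p`, `q`,
`r` are their coefficients. -/
theorem exists_eq_of_planar0_eq_lie1 (ha : a ≠ 0) {A : Ser × Ser} {h : Ser} (hA : ZFree A)
    (hh : pderiv ℝ 2 h = 0) (hc : planar0 a 0 0 h = lie1 a A) : ∃ (f : Ser) (p q r : ℝ),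
      pderiv ℝ 2 f = 0 ∧ A = planar0 a 0 0 f + (C p * X 0, C p * X 1 + C q * X 0) ∧
      h = lie0 a f + C r := by
  obtain ⟨f, r, hf, rfl, hr⟩ := exists_eq_op_add_form ha 0 hh
  obtain ⟨r, rfl⟩ := hr.eq_C
  have e0 : -((0 : ℕ) * a) = 0 := by simp
  have e1 : -((1 : ℕ) * a) = -a := by simp
  rw [e0, ← lie0_apply] at hc ⊢
  set B := A - planar0 a 0 0 f with hB
  have hBz : ZFree B := hA.sub (zFree_planar0 hf _ _ _)
  have hLB : lie1 a B = 0 := by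
    rw [hB, map_sub, lie1_planar0, ← hc, map_add, add_sub_cancel_left]
    simp [planar0_apply, op_apply]
  rw [lie1_apply, Prod.mk_eq_zero] at hLB
  obtain ⟨p, q, hp⟩ := (isForm_of_op ha 1 hBz.1 (by
    rw [e1, hLB.1]; intro d _; exact map_zero _)).eq_linear
  obtain ⟨u, v, hu⟩ := (isForm_of_op ha 1 hBz.2 (by
    rw [e1, eq_neg_of_add_eq_zero_left hLB.2, hp]
    have := isForm_one_linear (-2 * p) (-2 * q)
    have e : C (-2 * p) * X 0 + C (-2 * q) * X 1 = -(2 * (C p * X 0 + C q * X 1) : Ser) := by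
      simp [C_two]; ring
    rwa [e] at this)).eq_linear
  have hlin : (C (2 * p - 2 * v) * X 0 + C (2 * q) * X 1 : Ser) = 0 := by
    rw [← hLB.2, hp, hu]
    simp [op_apply, Derivation.leibniz, pderiv_X_of_ne, C_two]
    ring
  obtain ⟨h1, h2⟩ := eq_zero_of_linear_eq_zero hlin
  obtain rfl : v = p := by linarith
  obtain rfl : q = 0 := by linarith
  refine ⟨f, v, u, r, hf, ?_, rfl⟩
  rw [← sub_eq_iff_eq_add', ← hB]
  refine Prod.ext ?_ ?_
  · rw [hp]; simp
  · rw [hu]; ring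

/-- Degree `2` of the cone for `M = 0`. The parameters `-p`, `q`, `r` are the coefficients of
`Y₃₁`, `Y₂₃` and `2yz∂₃₁ + y²∂₁₂`. -/
theorem exists_eq_of_planar1_add_lie2 (ha : a ≠ 0) {g : Ser} {B : Ser × Ser}
    (hg : pderiv ℝ 2 g = 0) (hB : ZFree B) (hc : planar1 a 0 0 B + lie2 a g = 0) :
    ∃ (A : Ser × Ser) (h : Ser) (p q r : ℝ), ZFree A ∧ pderiv ℝ 2 h = 0 ∧
      g = planar1 a 0 0 A + C r * X 1 ^ 2 ∧
      B = planar0 a 0 0 h - lie1 a A +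
        (C p * X 0 - 2 * C r * X 1, C p * X 1 + C q * X 0) := by
  have e1 : -((1 : ℕ) * a) = -a := by simp
  have e2 : -((2 : ℕ) * a) = -2 * a := by push_cast; ring
  -- Subtracting the coboundary of `-(A₁, A₂)` leaves linear forms `b₁`, `b₂` in place of `B`.
  obtain ⟨A₁, b₁, hA₁, hB₁, hb₁⟩ := exists_eq_op_add_form ha 1 hB.1
  obtain ⟨A₂, b₂, hA₂, hB₂, hb₂⟩ := exists_eq_op_add_form ha 1 (g := B.2 - 2 * A₁) (by
    rw [map_sub, hB.2]; simp [Derivation.leibniz, pderiv_ofNat_two, hA₁])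
  rw [e1] at hB₁ hB₂
  obtain ⟨p, q, rfl⟩ := hb₁.eq_linear
  obtain ⟨u, v, rfl⟩ := hb₂.eq_linear
  have hAz : ZFree (A₁, A₂) := ⟨hA₁, hA₂⟩
  have hBe : B = lie1 a (A₁, A₂) + (C p * X 0 + C q * X 1, C u * X 0 + C v * X 1) := by
    rw [lie1_apply]
    exact Prod.ext hB₁ (by simp only [Prod.snd_add]; linear_combination hB₂)
  set G := g + planar1 a 0 0 (A₁, A₂) with hG
  have hLG : lie2 a G = C (p - v) * X 0 ^ 2 + C (2 * q) * (X 0 * X 1) := by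
    have h1 : lie2 a G =
        -planar1 a 0 0 (C p * X 0 + C q * X 1, C u * X 0 + C v * X 1) := by
      rw [hG, map_add, lie2_planar1, eq_neg_of_add_eq_zero_right hc, hBe, map_add]; ring
    rw [h1]
    simp [planar1_apply, op_apply, Derivation.leibniz, pderiv_X_of_ne, C_two]
    ring
  obtain ⟨α, β, δ, hα⟩ := (isForm_of_op ha 2 (f := G)
    (by rw [hG, map_add, hg, pderiv_two_planar1 hAz, add_zero]) (by
    rw [e2, ← lie2_apply, hLG]
    simpa using isForm_two_quadratic (p - v) (2 * q) 0)).eq_quadratic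
  have hq : (C (p - v + 2 * β) * X 0 ^ 2 + C (2 * q + 4 * δ) * (X 0 * X 1)
      + C 0 * X 1 ^ 2 : Ser) = 0 := by
    have h2 := hLG.symm
    rw [hα, ← sub_eq_zero] at h2
    rw [← h2]
    simp [lie2_apply, op_apply, Derivation.leibniz, pderiv_X_of_ne, C_two,
      show (C 4 : Ser) = 4 from map_ofNat C 4]
    ring
  obtain ⟨h1, h2, -⟩ := eq_zero_of_quadratic_eq_zero hq
  obtain rfl : v = p + 2 * β := by linarith
  obtain rfl : q = -2 * δ := by linarith
  -- The field `(-αx - (β/2)y)∂₁` has differential `αx² + βxy`, which removes these terms of `G`.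
  refine ⟨(C (-α) * X 0 + C (-β / 2) * X 1, 0) - (A₁, A₂), 0, p + β, u - 2 * α, δ, ?_,
    map_zero _, ?_, ?_⟩
  · refine ZFree.sub ⟨?_, ?_⟩ hAz <;> simp [Derivation.leibniz, pderiv_X_of_ne]
  · rw [map_sub, sub_add_eq_add_sub, eq_sub_iff_add_eq, ← hG, hα]
    have e : (C (-β / 2) : Ser) * 2 = -C β := by
      rw [← C_two, ← map_mul, ← map_neg]; congr 1; ring
    simp [planar1_apply, op_apply, Derivation.leibniz, pderiv_X_of_ne]
    linear_combination (X 0 * X 1) * e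
  · rw [map_zero, zero_sub, map_sub, neg_sub, hBe]
    have e : 2 * (C (-β / 2) : Ser) = -C β := by
      rw [← C_two, ← map_mul, ← map_neg]; congr 1; ring
    refine Prod.ext ?_ ?_
    · simp [lie1_apply, op_apply, Derivation.leibniz, pderiv_X_of_ne, C_two]
      linear_combination (-X 0) * e
    · simp [lie1_apply, op_apply, Derivation.leibniz, pderiv_X_of_ne, C_two]
      linear_combination X 1 * e

/-- Degree `3` of the cone for `M = 0`: on quadratic forms the Lie derivative is `-2x∂_y`, whose
image misses only `y²`. -/
theorem exists_eq_lie2_add (ha : a ≠ 0) {t : Ser} (ht : pderiv ℝ 2 t = 0) :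
    ∃ (g : Ser) (r : ℝ), t = lie2 a g + C r * X 1 ^ 2 := by
  obtain ⟨g, q, -, rfl, hq⟩ := exists_eq_op_add_form ha 2 ht
  obtain ⟨α, β, δ, rfl⟩ := hq.eq_quadratic
  have e2 : -((2 : ℕ) * a) = -2 * a := by push_cast; ring
  refine ⟨g + C (-α / 2) * (X 0 * X 1) + C (-β / 4) * X 1 ^ 2, δ, ?_⟩
  have h1 : (C (-α / 2) : Ser) * 2 = -C α := by
    rw [← C_two, ← map_mul, ← map_neg]; congr 1; ring
  have h2 : (C (-β / 4) : Ser) * 4 = -C β := by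
    rw [show (4 : Ser) = C 4 from (map_ofNat C 4).symm, ← map_mul, ← map_neg]; congr 1; ring
  rw [e2, ← lie2_apply, map_add, map_add]
  simp [lie2_apply, op_apply, Derivation.leibniz, pderiv_X_of_ne, C_two]
  linear_combination X 0 ^ 2 * h1 + X 0 * X 1 * h2

end Zero

/-! ### The part of positive weight in `z`

Here the planar complex has cohomology only in degree `2`, and the Lie derivative along `W` acts on
that cohomology as multiplication by `-2a`, so the total complex is exact. -/

section Pos

variable {a γ c : ℝ}

theorem exists_eq_of_planar0_eq_lie1_of_ne (ha : a ≠ 0) (hne : ∀ m : ℕ, γ * m + c ≠ 0)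
    {A : Ser × Ser} {h : Ser} (hA : planar1 a γ c A = 0) (hc : planar0 a γ c h = lie1 a A) :
    ∃ f, A = planar0 a γ c f ∧ h = lie0 a f := by
  obtain ⟨f, rfl⟩ := exists_planar0_eq ha hne hA
  refine ⟨f, rfl, sub_eq_zero.1 (eq_zero_of_planar0_eq_zero ha hne ?_)⟩
  rw [map_sub, hc, lie1_planar0, sub_self]

theorem coeff_eq_zero_of_pderiv {i : Fin 3} {u : Ser} (h : pderiv ℝ i u = 0) {d : Fin 3 →₀ ℕ}
    (hd : d i ≠ 0) : coeff d u = 0 := by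
  have := coeff_X_mul_pderiv i u d
  rw [h, mul_zero, map_zero] at this
  exact (mul_eq_zero.1 this.symm).resolve_left (by exact_mod_cast hd)

/-- Planar coboundaries lie in the ideal generated by `x` and `y`. -/
theorem coeff_planar1_eq_zero (A : Ser × Ser) {d : Fin 3 →₀ ℕ} (h0 : d 0 = 0) (h1 : d 1 = 0) :
    coeff d (planar1 a γ c A) = 0 := by
  have e : planar1 a γ c A = X 0 * (X 0 * (pderiv ℝ 0 A.1 + pderiv ℝ 1 A.2) - 2 * A.1
      - op 0 0 γ c (C a * A.2 + 2 * A.1)) + X 1 * (C a * op 0 0 γ c A.1) := by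
    simp [planar1_apply, op_apply, Derivation.leibniz, pderiv_X_of_ne, pderiv_ofNat_two]
    ring
  rw [e, map_add, coeff_X_mul_eq_ite, coeff_X_mul_eq_ite, if_pos h0, if_pos h1, add_zero]

theorem lie2_of_pderiv {u : Ser} (h0 : pderiv ℝ 0 u = 0) (h1 : pderiv ℝ 1 u = 0) :
    lie2 a u = C (-2 * a) * u := by
  simp [lie2_apply, op_apply, h0, h1]

theorem exists_eq_of_planar1_add_lie2_of_ne (ha : a ≠ 0) (hne : ∀ m : ℕ, γ * m + c ≠ 0)
    {g : Ser} {B : Ser × Ser} (hc : planar1 a γ c B + lie2 a g = 0) :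
    ∃ A h, g = planar1 a γ c A ∧ B = planar0 a γ c h - lie1 a A := by
  obtain ⟨A, u, rfl, h0, h1⟩ := exists_eq_planar1_add ha hne g
  have hu : u = 0 := by
    rw [map_add, lie2_planar1, lie2_of_pderiv h0 h1, ← add_assoc, ← map_add] at hc
    ext d
    by_cases hd : d 0 = 0 ∧ d 1 = 0
    · have := congrArg (coeff d) hc
      rw [map_add, coeff_planar1_eq_zero _ hd.1 hd.2, coeff_C_mul, zero_add, map_zero] at this
      exact (mul_eq_zero.1 this).resolve_left (mul_ne_zero (by norm_num) ha)
    · rw [not_and_or] at hd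
      rcases hd with hd | hd
      · exact coeff_eq_zero_of_pderiv h0 hd
      · exact coeff_eq_zero_of_pderiv h1 hd
  subst hu
  rw [add_zero, lie2_planar1, ← map_add] at hc
  obtain ⟨h, hh⟩ := exists_planar0_eq ha hne hc
  exact ⟨A, h, add_zero _, by rw [hh, add_sub_cancel_right]⟩

theorem exists_eq_planar1_add_lie2_of_ne (ha : a ≠ 0) (hne : ∀ m : ℕ, γ * m + c ≠ 0)
    (t : Ser) : ∃ B g, t = planar1 a γ c B + lie2 a g := by
  obtain ⟨B, u, rfl, h0, h1⟩ := exists_eq_planar1_add ha hne t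
  refine ⟨B, C (-2 * a)⁻¹ * u, ?_⟩
  rw [lie2_of_pderiv (by simp [Derivation.leibniz, h0]) (by simp [Derivation.leibniz, h1]),
    ← mul_assoc, ← map_mul, mul_inv_cancel₀ (mul_ne_zero (by norm_num) ha), map_one, one_mul]

end Pos

end DufourHaraki

/-! ### Cocycles are combinations of the representatives modulo coboundaries -/

namespace DufourHaraki

open FormalMultivector MvPowerSeries

section Cohomology

variable {a : ℝ}

theorem exists_eq_C_of_diff0 (ha : a ≠ 0) {f : Ser} (hf : diff0 a f = 0) : ∃ r, f = C r := by
  classical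
  obtain ⟨h12, h3⟩ := Prod.mk_eq_zero.1 hf
  obtain ⟨h1, h2⟩ := Prod.mk_eq_zero.1 h12
  have h1' := (mul_eq_zero.1 h1).resolve_left (X_ne_zero 0)
  rw [h1', mul_zero, zero_add] at h2
  have h2' := (mul_eq_zero.1 h2).resolve_left (X_ne_zero 0)
  have h3' := (mul_eq_zero.1 h3).resolve_left (X_ne_zero 2)
  refine ⟨coeff 0 f, MvPowerSeries.ext fun d => ?_⟩
  rw [coeff_C]
  split_ifs with hd
  · rw [hd]
  by_cases h01 : d 0 + d 1 = 0
  -- On `xⁱyʲzᵐ` the diagonal parts of the two operators are `2m - (i + j)` and `a(i + j)`.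
  · refine coeff_eq_zero_of_coeff_op _ _ _ _ f (fun d _ => by rw [h2', map_zero]) d ?_
    have hd2 : d 2 ≠ 0 := by
      intro h; apply hd; ext i; fin_cases i <;> simp <;> omega
    rw [h01]
    simpa using hd2
  · refine coeff_eq_zero_of_coeff_op _ _ _ _ f (fun d _ => by rw [← lie0_apply, h3', map_zero]) d ?_
    have : ((d 0 + d 1 : ℕ) : ℝ) ≠ 0 := by exact_mod_cast h01
    simpa [ha] using this

theorem zero_mul_add_neg_one_ne (m : ℕ) : (0 : ℝ) * m + -1 ≠ 0 := by simp

theorem one_mul_add_one_ne (m : ℕ) : (1 : ℝ) * m + 1 ≠ 0 := by positivity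

/-- The `∂₃`-component of a vector field splits into its parts of weight `-1`, `0` and positive
weight in `z`, where `∂₃` has weight `-1`. -/
theorem planar0_split {h₀ h₁ : Ser} (hh₀ : pderiv ℝ 2 h₀ = 0) (hh₁ : pderiv ℝ 2 h₁ = 0)
    (h₂ : Ser) : planar0 a 1 (-1) (h₀ + X 2 * (h₁ + X 2 * h₂)) =
      planar0 a 0 (-1) h₀ + (X 2 : Ser) • (planar0 a 0 0 h₁ + (X 2 : Ser) • planar0 a 1 1 h₂) := by
  have e1 : (1 : ℝ) + -1 = 0 := by norm_num
  rw [map_add, planar0_X_two_mul, e1, map_add, planar0_X_two_mul, add_zero,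
    planar0_of_pderiv_two hh₀ a 1 0, planar0_of_pderiv_two hh₁ a 1 0]

theorem planar1_split {B₀ B₁ : Ser × Ser} (hB₀ : ZFree B₀) (hB₁ : ZFree B₁)
    (B₂ : Ser × Ser) : planar1 a 1 (-1) (B₀ + (X 2 : Ser) • (B₁ + (X 2 : Ser) • B₂)) =
      planar1 a 0 (-1) B₀ + X 2 * (planar1 a 0 0 B₁ + X 2 * planar1 a 1 1 B₂) := by
  have e1 : (1 : ℝ) + -1 = 0 := by norm_num
  rw [map_add, planar1_X_two_smul, e1, map_add, planar1_X_two_smul, add_zero,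
    planar1_of_pderiv_two hB₀.1 hB₀.2 a 1 0, planar1_of_pderiv_two hB₁.1 hB₁.2 a 1 0]

theorem exists_eq_of_diff1_eq_zero (ha : a ≠ 0) {P : (Ser × Ser) × Ser} (hP : diff1 a P = 0) :
    ∃ (f : Ser) (p q r : ℝ),
      P = diff0 a f + ((C p * X 0, C p * X 1 + C q * X 0), C r * X 2) := by
  obtain ⟨A, h⟩ := P
  obtain ⟨A₀, A₁, hA₀, rfl⟩ := exists_eq_add_X_two_smul A
  obtain ⟨h₀, h', hh₀, rfl⟩ := exists_eq_add_X_two_mul h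
  obtain ⟨h₁, h₂, hh₁, rfl⟩ := exists_eq_add_X_two_mul h'
  obtain ⟨hc1, hc2⟩ := Prod.mk_eq_zero.1 hP
  dsimp only at hc1 hc2
  rw [map_add, planar1_X_two_smul, add_zero, planar1_of_pderiv_two hA₀.1 hA₀.2 a 1 0] at hc1
  obtain ⟨-, hc11⟩ := eq_zero_of_add_X_two_mul_eq_zero (pderiv_two_planar1 hA₀ _ _ _) hc1
  rw [planar0_split hh₀ hh₁, map_add, lie1_X_two_smul, add_sub_assoc, ← smul_sub] at hc2
  obtain ⟨hc20, hc2⟩ := eq_zero_of_add_X_two_smul_eq_zero (zFree_planar0 hh₀ _ _ _) hc2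
  rw [add_sub_add_comm, ← smul_sub] at hc2
  obtain ⟨hc21, hc22⟩ := eq_zero_of_add_X_two_smul_eq_zero
    ((zFree_planar0 hh₁ _ _ _).sub (zFree_lie1 hA₀ a)) hc2
  obtain rfl := eq_zero_of_planar0_eq_zero ha zero_mul_add_neg_one_ne hc20
  obtain ⟨f₀, p, q, r, hf₀, rfl, rfl⟩ :=
    exists_eq_of_planar0_eq_lie1 ha hA₀ hh₁ (sub_eq_zero.1 hc21)
  obtain ⟨f₁, rfl, rfl⟩ :=
    exists_eq_of_planar0_eq_lie1_of_ne ha one_mul_add_one_ne hc11 (sub_eq_zero.1 hc22)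
  refine ⟨f₀ + X 2 * f₁, p, q, r, Prod.ext ?_ ?_⟩
  · simp only [diff0, Prod.fst_add]
    rw [map_add, planar0_X_two_mul, add_zero, planar0_of_pderiv_two hf₀ a 1 0]
    abel
  · simp only [diff0, Prod.snd_add, map_add, lie0_X_two_mul]
    ring

theorem exists_eq_of_diff2_eq_zero (ha : a ≠ 0) {S : Ser × (Ser × Ser)} (hS : diff2 a S = 0) :
    ∃ (P : (Ser × Ser) × Ser) (p q r : ℝ), S = diff1 a P +
      (C r * X 1 ^ 2,
        (C p * (X 0 * X 2) - 2 * C r * (X 1 * X 2), C p * (X 1 * X 2) + C q * (X 0 * X 2))) := by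
  obtain ⟨g, B⟩ := S
  obtain ⟨g₀, g₁, hg₀, rfl⟩ := exists_eq_add_X_two_mul g
  obtain ⟨B₀, B', hB₀, rfl⟩ := exists_eq_add_X_two_smul B
  obtain ⟨B₁, B₂, hB₁, rfl⟩ := exists_eq_add_X_two_smul B'
  simp only [diff2] at hS
  rw [planar1_split hB₀ hB₁, map_add, lie2_X_two_mul, add_assoc, ← mul_add] at hS
  obtain ⟨hc0, hS⟩ := eq_zero_of_add_X_two_mul_eq_zero (pderiv_two_planar1 hB₀ _ _ _) hS
  rw [add_add_add_comm, ← mul_add] at hS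
  obtain ⟨hc1, hc2⟩ := eq_zero_of_add_X_two_mul_eq_zero (by
    rw [map_add, pderiv_two_planar1 hB₁, pderiv_two_lie2 hg₀, add_zero]) hS
  obtain ⟨h₀, hh₀⟩ := exists_planar0_eq ha zero_mul_add_neg_one_ne hc0
  have hh₀' : planar0 a 0 (-1) (atZeroZ h₀) = B₀ := by
    have e (f : Ser) (hf : pderiv ℝ 2 f = 0) := atZeroZ_of_pderiv_two hf
    refine Prod.ext ?_ ?_
    · rw [← e _ hB₀.1, ← hh₀]
      simp only [planar0_apply]
      rw [atZeroZ_X_mul (by decide), atZeroZ_op]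
    · rw [← e _ hB₀.2, ← hh₀]
      simp only [planar0_apply]
      rw [map_add, atZeroZ_X_mul (by decide), atZeroZ_X_mul (by decide), atZeroZ_op, atZeroZ_op]
  obtain ⟨A₀, h₁, p, q, r, hA₀, hh₁, rfl, rfl⟩ := exists_eq_of_planar1_add_lie2 ha hg₀ hB₁ hc1
  obtain ⟨A₁, h₂, rfl, rfl⟩ := exists_eq_of_planar1_add_lie2_of_ne ha one_mul_add_one_ne hc2
  refine ⟨(A₀ + (X 2 : Ser) • A₁, atZeroZ h₀ + X 2 * (h₁ + X 2 * h₂)), p, q, r, Prod.ext ?_ ?_⟩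
  · simp only [diff1, Prod.fst_add]
    rw [map_add, planar1_X_two_smul, add_zero, planar1_of_pderiv_two hA₀.1 hA₀.2 a 1 0]
    ring
  · simp only [diff1, Prod.snd_add]
    rw [planar0_split (pderiv_two_atZeroZ _) hh₁, map_add, lie1_X_two_smul, hh₀']
    refine Prod.ext ?_ ?_
    · simp only [Prod.fst_add, Prod.fst_sub, Prod.smul_fst, smul_eq_mul]; ring
    · simp only [Prod.snd_add, Prod.snd_sub, Prod.smul_snd, smul_eq_mul]; ring

theorem exists_eq_diff2_add (ha : a ≠ 0) (t : Ser) : ∃ (S : Ser × (Ser × Ser)) (p q : ℝ),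
    t = diff2 a S + (C p + C q * (X 1 ^ 2 * X 2)) := by
  obtain ⟨t₀, t', ht₀, rfl⟩ := exists_eq_add_X_two_mul t
  obtain ⟨t₁, t₂, ht₁, rfl⟩ := exists_eq_add_X_two_mul t'
  obtain ⟨B, u, hB, hu0, hu1⟩ := exists_eq_planar1_add ha zero_mul_add_neg_one_ne t₀
  set B₀ : Ser × Ser := (atZeroZ B.1, atZeroZ B.2)
  have hB₀ : ZFree B₀ := ⟨pderiv_two_atZeroZ _, pderiv_two_atZeroZ _⟩
  have h02 : (0 : Fin 3) ≠ 2 := by decide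
  have h12 : (1 : Fin 3) ≠ 2 := by decide
  have ht₀' : t₀ = planar1 a 0 (-1) B₀ + atZeroZ u := by
    have e (A : Ser × Ser) : planar1 a 0 (-1) A =
        X 0 * (X 0 * (pderiv ℝ 0 A.1 + pderiv ℝ 1 A.2)) - C 2 * (X 0 * A.1)
          - op 0 0 0 (-1) (C a * (X 0 * A.2) - (C a * (X 1 * A.1) - C 2 * (X 0 * A.1))) := by
      rw [planar1_apply, C_two]; ring_nf
    rw [← atZeroZ_of_pderiv_two ht₀, hB, map_add, e, e]
    simp only [map_sub, map_add, atZeroZ_op, atZeroZ_X_mul h02, atZeroZ_X_mul h12, atZeroZ_C_mul,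
      atZeroZ_pderiv h02, atZeroZ_pderiv h12, B₀]
  obtain ⟨p, hp⟩ : ∃ p, atZeroZ u = C p := by
    refine IsForm.eq_C fun d hd => ?_
    by_cases h2 : d 2 = 0
    · rw [atZeroZ, coeff_restrict_of h2]
      by_cases h0 : d 0 = 0
      · exact coeff_eq_zero_of_pderiv hu1 (by omega)
      · exact coeff_eq_zero_of_pderiv hu0 h0
    · exact coeff_restrict_of_not h2 u
  obtain ⟨g₀, q, rfl⟩ := exists_eq_lie2_add ha ht₁
  obtain ⟨B₂, g₁, rfl⟩ := exists_eq_planar1_add_lie2_of_ne ha one_mul_add_one_ne t₂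
  refine ⟨(g₀ + X 2 * g₁, B₀ + (X 2 : Ser) • (0 + (X 2 : Ser) • B₂)), p, q, ?_⟩
  simp only [diff2]
  rw [planar1_split hB₀ ⟨map_zero _, map_zero _⟩, ht₀', hp, map_add (lie2 a), lie2_X_two_mul,
    map_zero]
  ring

/-! ### Nontrivial combinations of the representatives are not coboundaries -/

/-- The exponent of the monomial `xⁱyʲzᵐ`. -/
noncomputable def expo (i j m : ℕ) : Fin 3 →₀ ℕ :=
  Finsupp.single 0 i + Finsupp.single 1 j + Finsupp.single 2 m

theorem expo_zero (i j m : ℕ) : expo i j m 0 = i := by simp [expo]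
theorem expo_one (i j m : ℕ) : expo i j m 1 = j := by simp [expo]
theorem expo_two (i j m : ℕ) : expo i j m 2 = m := by simp [expo]

theorem coeff_expo_X_zero_mul (i j m : ℕ) (f : Ser) :
    coeff (expo (i + 1) j m) (X 0 * f) = coeff (expo i j m) f := by
  rw [coeff_X_mul_eq_ite, if_neg (by simp [expo])]
  congr 2
  ext k; fin_cases k <;> simp [expo]

theorem coeff_expo_X_one_mul (i j m : ℕ) (f : Ser) :
    coeff (expo i (j + 1) m) (X 1 * f) = coeff (expo i j m) f := by
  rw [coeff_X_mul_eq_ite, if_neg (by simp [expo])]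
  congr 2
  ext k; fin_cases k <;> simp [expo]

theorem coeff_expo_X_two_mul (i j m : ℕ) (f : Ser) :
    coeff (expo i j (m + 1)) (X 2 * f) = coeff (expo i j m) f := by
  rw [coeff_X_mul_eq_ite, if_neg (by simp [expo])]
  congr 2
  ext k; fin_cases k <;> simp [expo]

theorem coeff_expo_zero_X_mul (j m : ℕ) (f : Ser) : coeff (expo 0 j m) (X 0 * f) = 0 := by
  rw [coeff_X_mul_eq_ite, if_pos (by simp [expo])]

theorem coeff_expo_zero_X_one_mul (i m : ℕ) (f : Ser) : coeff (expo i 0 m) (X 1 * f) = 0 := by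
  rw [coeff_X_mul_eq_ite, if_pos (by simp [expo])]

theorem coeff_expo_zero_X_two_mul (i j : ℕ) (f : Ser) : coeff (expo i j 0) (X 2 * f) = 0 := by
  rw [coeff_X_mul_eq_ite, if_pos (by simp [expo])]

theorem coeff_expo_op (α β γ c : ℝ) (f : Ser) (i j m : ℕ) : coeff (expo i j m) (op α β γ c f) =
    (α * (i + j : ℕ) + γ * m + c) * coeff (expo i j m) f +
      β * if i = 0 then 0 else (j + 1) * coeff (expo (i - 1) (j + 1) m) f := by
  have e : expo i j m - Finsupp.single 0 1 + Finsupp.single 1 1 = expo (i - 1) (j + 1) m := by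
    ext k; fin_cases k <;> simp [expo]
  rw [coeff_op, expo_zero, expo_one, expo_two, e]

theorem coeff_expo_pderiv_zero (i j m : ℕ) (f : Ser) :
    coeff (expo i j m) (pderiv ℝ 0 f) = coeff (expo (i + 1) j m) f * (i + 1) := by
  rw [coeff_pderiv, expo_zero]
  congr 3
  ext k; fin_cases k <;> simp [expo]

theorem coeff_expo_pderiv_one (i j m : ℕ) (f : Ser) :
    coeff (expo i j m) (pderiv ℝ 1 f) = coeff (expo i (j + 1) m) f * (j + 1) := by
  rw [coeff_pderiv, expo_one]
  congr 3
  ext k; fin_cases k <;> simp [expo]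

theorem coeff_expo_C (r : ℝ) : coeff (expo 0 0 0) (C r : Ser) = r := by
  classical
  rw [coeff_C, if_pos (by simp [expo])]

theorem eq_zero_of_eq_diff0 {f : Ser} {p q r : ℝ}
    (h : ((C p * X 0, C p * X 1 + C q * X 0), C r * X 2) = diff0 a f) :
    p = 0 ∧ q = 0 ∧ r = 0 := by
  simp only [diff0, planar0_apply, Prod.mk.injEq] at h
  obtain ⟨⟨h1, h2⟩, h3⟩ := h
  rw [mul_comm (C p)] at h1
  have h1' := mul_left_cancel₀ (X_ne_zero 0) h1
  rw [mul_comm (C p), ← h1', add_right_inj, mul_comm (C q)] at h2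
  rw [mul_comm (C r)] at h3
  have hp := congrArg (coeff (expo 0 0 0)) h1'
  have hq := congrArg (coeff (expo 0 0 0)) (mul_left_cancel₀ (X_ne_zero 0) h2)
  have hr := congrArg (coeff (expo 0 0 0)) (mul_left_cancel₀ (X_ne_zero 2) h3)
  rw [lie0_apply] at hr
  rw [coeff_expo_op, coeff_expo_C] at hp hq hr
  simpa using And.intro hp (And.intro hq hr)

theorem coeff_planar1_y_sq (A : Ser × Ser) : coeff (expo 0 2 0) (planar1 a 1 0 A) = 0 := by
  have e : planar1 a 1 0 A = X 0 * (X 0 * (pderiv ℝ 0 A.1 + pderiv ℝ 1 A.2) - 2 * A.1)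
      - op 0 0 1 0 (C a * X 0 * A.2 - (C a * X 1 - 2 * X 0) * A.1) := by
    rw [planar1_apply]; ring
  rw [e, map_sub, coeff_expo_op, coeff_expo_zero_X_mul]
  simp

theorem coeff_planar1_x_sq (A : Ser × Ser) : coeff (expo 2 0 0) (planar1 a 1 0 A) =
    coeff (expo 0 1 0) A.2 - coeff (expo 1 0 0) A.1 := by
  have e : planar1 a 1 0 A = X 0 * (X 0 * (pderiv ℝ 0 A.1 + pderiv ℝ 1 A.2) - C 2 * A.1)
      - op 0 0 1 0 (C a * X 0 * A.2 - (C a * X 1 - 2 * X 0) * A.1) := by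
    rw [planar1_apply, C_two]; ring
  rw [e, map_sub, coeff_expo_op, coeff_expo_X_zero_mul, map_sub, coeff_expo_X_zero_mul, map_add,
    coeff_expo_pderiv_zero, coeff_expo_pderiv_one, coeff_C_mul]
  norm_num
  ring

theorem eq_zero_of_eq_diff1 {P : (Ser × Ser) × Ser} {p q r : ℝ}
    (h : (C r * X 1 ^ 2, (C p * (X 0 * X 2) - 2 * C r * (X 1 * X 2),
      C p * (X 1 * X 2) + C q * (X 0 * X 2))) = diff1 a P) : p = 0 ∧ q = 0 ∧ r = 0 := by
  obtain ⟨A, f⟩ := P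
  have h0 := congrArg (fun S => S.1) h
  have h1 := congrArg (fun S => S.2.1) h
  have h2 := congrArg (fun S => S.2.2) h
  simp only [diff1, planar0_apply, lie1_apply, Prod.fst_sub, Prod.snd_sub, Prod.smul_fst,
    Prod.smul_snd, smul_eq_mul] at h0 h1 h2
  have hm (i j m : ℕ) (d : Fin 3 →₀ ℕ) := coeff_monomial_eq i j m d
  have hr : r = 0 := by
    have := congrArg (coeff (expo 0 2 0)) h0
    rw [coeff_planar1_y_sq] at this
    have e : (X 1 ^ 2 : Ser) = X 0 ^ 0 * X 1 ^ 2 * X 2 ^ 0 := by ring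
    rw [e, coeff_C_mul, hm] at this
    simpa [expo_zero, expo_one, expo_two] using this
  subst hr
  -- The functional `coeff_y A₂ - coeff_x A₁` also occurs in the `xz`-coefficient of `B₂`.
  have hsp : coeff (expo 0 1 0) A.2 = coeff (expo 1 0 0) A.1 := by
    have := congrArg (coeff (expo 2 0 0)) h0
    rw [coeff_planar1_x_sq] at this
    simp at this
    linarith
  simp only [map_zero, mul_zero, zero_mul, sub_zero] at h1
  have exz : (X 0 * X 2 : Ser) = X 0 ^ 1 * X 1 ^ 0 * X 2 ^ 1 := by ring
  have eyz : (X 1 * X 2 : Ser) = X 0 ^ 0 * X 1 ^ 1 * X 2 ^ 1 := by ring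
  rw [exz] at h1
  rw [exz, eyz, ← C_two] at h2
  have h1x := congrArg (coeff (expo 1 0 1)) h1
  have h2y := congrArg (coeff (expo 0 1 1)) h2
  have h2x := congrArg (coeff (expo 1 0 1)) h2
  simp only [map_add, map_sub, coeff_C_mul, hm, expo_zero, expo_one, expo_two,
    coeff_expo_X_zero_mul 0, coeff_expo_X_one_mul _ 0, coeff_expo_X_two_mul _ _ 0,
    coeff_expo_zero_X_mul, coeff_expo_zero_X_one_mul, coeff_expo_op] at h1x h2y h2x
  norm_num at h1x h2y h2x
  refine ⟨?_, ?_, rfl⟩ <;> linarith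

theorem eq_zero_of_eq_diff2 {S : Ser × (Ser × Ser)} {p q : ℝ}
    (h : C p + C q * (X 1 ^ 2 * X 2) = diff2 a S) : p = 0 ∧ q = 0 := by
  obtain ⟨g, B⟩ := S
  have eyz : (X 1 ^ 2 * X 2 : Ser) = X 0 ^ 0 * X 1 ^ 2 * X 2 ^ 1 := by ring
  have h1 : (C p : Ser) = C p * (X 0 ^ 0 * X 1 ^ 0 * X 2 ^ 0) := by ring
  have e : planar1 a 1 (-1) B = X 0 * (X 0 * (pderiv ℝ 0 B.1 + pderiv ℝ 1 B.2) - 2 * B.1)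
      - op 0 0 1 (-1) (X 0 * (C a * B.2 + 2 * B.1) - X 1 * (C a * B.1)) := by
    rw [planar1_apply]; ring_nf
  simp only [diff2, e, lie2_apply] at h
  rw [h1, eyz] at h
  have hp := congrArg (coeff (expo 0 0 0)) h
  have hq := congrArg (coeff (expo 0 2 1)) h
  simp only [map_add, map_sub, coeff_C_mul, coeff_monomial_eq, expo_zero, expo_one, expo_two,
    coeff_expo_X_two_mul _ _ 0, coeff_expo_zero_X_two_mul,
    coeff_expo_zero_X_mul, coeff_expo_zero_X_one_mul, coeff_expo_op] at hp hq
  norm_num at hp hq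
  refine ⟨?_, ?_⟩ <;> linarith

end Cohomology

/-! ### Cocycles and coboundaries of `Λ₃` -/

/-- The property `RepresentsBasis` in terms of cocycles and coboundaries, without the quotient. -/
theorem representsBasis_of {κ : Type} [Fintype κ] {n : ℕ} {Λ : FormalMultivector n} {p : ℕ}
    {c : κ → FormalMultivector n} (hc : ∀ i, c i ∈ cocycles Λ p)
    (hli : ∀ r : κ → ℝ, ∑ i, r i • c i ∈ coboundaries Λ p → r = 0)
    (hspan : ∀ P ∈ cocycles Λ p, ∃ r : κ → ℝ, P - ∑ i, r i • c i ∈ coboundaries Λ p) :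
    RepresentsBasis Λ p c := by
  let v : κ → Cohomology Λ p := fun i => Submodule.Quotient.mk ⟨c i, hc i⟩
  have hv (r : κ → ℝ) : ∑ i, r i • v i =
      Submodule.Quotient.mk (∑ i, r i • (⟨c i, hc i⟩ : cocycles Λ p)) := by
    simp only [v, ← Submodule.mkQ_apply, map_sum, map_smul]
  have hli' : LinearIndependent ℝ v := by
    rw [Fintype.linearIndependent_iff]
    intro r hr
    rw [hv, Submodule.Quotient.mk_eq_zero, Submodule.submoduleOf, Submodule.mem_comap] at hr
    exact fun i => congrFun (hli r (by simpa using hr)) i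
  have hspan' : ⊤ ≤ Submodule.span ℝ (Set.range v) := by
    rintro q -
    obtain ⟨⟨P, hP⟩, rfl⟩ := Submodule.Quotient.mk_surjective _ q
    obtain ⟨r, hr⟩ := hspan P hP
    have : Submodule.Quotient.mk ⟨P, hP⟩ = ∑ i, r i • v i := by
      rw [hv, Submodule.Quotient.eq, Submodule.submoduleOf, Submodule.mem_comap]
      simpa using hr
    rw [this]
    exact Submodule.sum_mem _ fun i _ => Submodule.smul_mem _ _ (Submodule.subset_span ⟨i, rfl⟩)
  exact ⟨hc, Module.Basis.mk hli' hspan', fun i => Module.Basis.mk_apply hli' hspan' i⟩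

section Complex

variable (a : ℝ)

theorem mem_cocycles_zero {P : FormalMultivector 3} :
    P ∈ cocycles (Λ3 a) 0 ↔ ∃ f, P = field0 f ∧ diff0 a f = 0 := by
  simp only [cocycles, Submodule.mem_inf, homogeneous_zero_eq, LinearMap.mem_range,
    LinearMap.mem_ker]
  constructor
  · rintro ⟨⟨f, rfl⟩, h⟩
    rw [schouten_Λ3_field0] at h
    exact ⟨f, rfl, field1_injective (h.trans (map_zero _).symm)⟩
  · rintro ⟨f, rfl, h⟩
    exact ⟨⟨f, rfl⟩, by rw [schouten_Λ3_field0, h, map_zero]⟩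

theorem mem_cocycles_one {P : FormalMultivector 3} :
    P ∈ cocycles (Λ3 a) 1 ↔ ∃ V, P = field1 V ∧ diff1 a V = 0 := by
  simp only [cocycles, Submodule.mem_inf, homogeneous_one_eq, LinearMap.mem_range,
    LinearMap.mem_ker]
  constructor
  · rintro ⟨⟨f, rfl⟩, h⟩
    rw [schouten_Λ3_field1] at h
    exact ⟨f, rfl, field2_injective (h.trans (map_zero _).symm)⟩
  · rintro ⟨f, rfl, h⟩
    exact ⟨⟨f, rfl⟩, by rw [schouten_Λ3_field1, h, map_zero]⟩

theorem mem_cocycles_two {P : FormalMultivector 3} :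
    P ∈ cocycles (Λ3 a) 2 ↔ ∃ S, P = field2 S ∧ diff2 a S = 0 := by
  simp only [cocycles, Submodule.mem_inf, homogeneous_two_eq, LinearMap.mem_range,
    LinearMap.mem_ker]
  constructor
  · rintro ⟨⟨f, rfl⟩, h⟩
    rw [schouten_Λ3_field2] at h
    exact ⟨f, rfl, field3_injective (h.trans (map_zero _).symm)⟩
  · rintro ⟨f, rfl, h⟩
    exact ⟨⟨f, rfl⟩, by rw [schouten_Λ3_field2, h, map_zero]⟩

theorem schouten_Λ3_field3 (t : Ser) : schouten (Λ3 a) (field3 t) = 0 := by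
  rw [Λ3_eq, schouten_field2_field3]

theorem mem_cocycles_three {P : FormalMultivector 3} :
    P ∈ cocycles (Λ3 a) 3 ↔ ∃ t, P = field3 t := by
  simp only [cocycles, Submodule.mem_inf, homogeneous_three_eq, LinearMap.mem_range,
    LinearMap.mem_ker]
  constructor
  · rintro ⟨⟨f, rfl⟩, h⟩
    exact ⟨f, rfl⟩
  · rintro ⟨f, rfl⟩
    exact ⟨⟨f, rfl⟩, schouten_Λ3_field3 a f⟩

theorem field1_mem_coboundaries {V : (Ser × Ser) × Ser} :
    field1 V ∈ coboundaries (Λ3 a) 1 ↔ ∃ f, V = diff0 a f := by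
  rw [coboundaries, homogeneous_zero_eq]
  constructor
  · rintro ⟨_, ⟨f, rfl⟩, h⟩
    exact ⟨f, field1_injective (h.symm.trans (schouten_Λ3_field0 a f))⟩
  · rintro ⟨f, rfl⟩
    exact ⟨_, ⟨f, rfl⟩, schouten_Λ3_field0 a f⟩

theorem field2_mem_coboundaries {S : Ser × (Ser × Ser)} :
    field2 S ∈ coboundaries (Λ3 a) 2 ↔ ∃ V, S = diff1 a V := by
  rw [coboundaries, homogeneous_one_eq]
  constructor
  · rintro ⟨_, ⟨V, rfl⟩, h⟩
    exact ⟨V, field2_injective (h.symm.trans (schouten_Λ3_field1 a V))⟩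
  · rintro ⟨V, rfl⟩
    exact ⟨_, ⟨V, rfl⟩, schouten_Λ3_field1 a V⟩

theorem field3_mem_coboundaries {t : Ser} :
    field3 t ∈ coboundaries (Λ3 a) 3 ↔ ∃ S, t = diff2 a S := by
  rw [coboundaries, homogeneous_two_eq]
  constructor
  · rintro ⟨_, ⟨S, rfl⟩, h⟩
    exact ⟨S, field3_injective (h.symm.trans (schouten_Λ3_field2 a S))⟩
  · rintro ⟨S, rfl⟩
    exact ⟨_, ⟨S, rfl⟩, schouten_Λ3_field2 a S⟩

theorem coboundaries_le_cocycles (p : ℕ) : coboundaries (Λ3 a) p ≤ cocycles (Λ3 a) p := by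
  match p with
  | 0 => exact bot_le
  | 1 =>
    rw [coboundaries, homogeneous_zero_eq]
    rintro _ ⟨_, ⟨f, rfl⟩, rfl⟩
    rw [schouten_Λ3_field0]
    exact (mem_cocycles_one a).2 ⟨_, rfl, diff1_diff0 a f⟩
  | 2 =>
    rw [coboundaries, homogeneous_one_eq]
    rintro _ ⟨_, ⟨P, rfl⟩, rfl⟩
    rw [schouten_Λ3_field1]
    exact (mem_cocycles_two a).2 ⟨_, rfl, diff2_diff1 a P⟩
  | 3 =>
    rw [coboundaries, homogeneous_two_eq]
    rintro _ ⟨_, ⟨S, rfl⟩, rfl⟩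
    rw [schouten_Λ3_field2]
    exact (mem_cocycles_three a).2 ⟨_, rfl⟩
  | 4 =>
    rw [coboundaries, homogeneous_three_eq]
    rintro _ ⟨_, ⟨t, rfl⟩, rfl⟩
    rw [schouten_Λ3_field3]
    exact zero_mem _
  | p + 5 =>
    rw [coboundaries, homogeneous_eq_bot (by omega), Submodule.map_bot]
    exact bot_le

end Complex

end DufourHaraki

open FormalMultivector DufourHaraki in
theorem mainTheorem11 (a : ℝ) (ha : a ≠ 0) :
    -- the tensor is Poisson, and the bracket with it defines a complex
    schouten (Λ3 a) (Λ3 a) = 0 ∧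
    (∀ p : ℕ, coboundaries (Λ3 a) p ≤ cocycles (Λ3 a) p) ∧
    -- the cohomology spaces
    RepresentsBasis (Λ3 a) 0 ![1] ∧
    RepresentsBasis (Λ3 a) 1 ![Y1, Y2, Y3] ∧
    RepresentsBasis (Λ3 a) 2
      ![Y2 * Y3, Y3 * Y1, (2 : ℝ) • (y * z * (d3 * d1)) + y ^ 2 * (d1 * d2)] ∧
    RepresentsBasis (Λ3 a) 3 ![d1 * d2 * d3, y ^ 2 * z * (d1 * d2 * d3)] ∧
    (∀ p : ℕ, 3 < p → Subsingleton (Cohomology (Λ3 a) p)) := by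
  open MvPowerSeries in
  refine ⟨?_, coboundaries_le_cocycles a, ?_, ?_, ?_, ?_, ?_⟩
  · nth_rewrite 2 [Λ3_eq]
    rw [schouten_Λ3_field2]
    refine (congrArg field3 ?_).trans (map_zero _)
    simp [diff2, planar1_apply, lie2_apply, op_apply, C_two, Derivation.leibniz, pderiv_X_of_ne,
      pderiv_ofNat_two]
    ring
  · refine representsBasis_of ?_ ?_ ?_
    · simp only [Fin.forall_fin_one, Matrix.cons_val_fin_one]
      refine (mem_cocycles_zero a).2 ⟨1, one_eq_field0, ?_⟩
      simp [diff0, planar0_apply, lie0_apply, op_apply, Derivation.map_one_eq_zero]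
    · intro r hr
      simp only [Fin.sum_univ_one, Matrix.cons_val_fin_one, one_eq_field0, ← map_smul] at hr
      have h := field0_injective ((Submodule.mem_bot ℝ).1 hr |>.trans (map_zero _).symm)
      ext i
      fin_cases i
      simpa using h
    · intro P hP
      obtain ⟨f, rfl, hf⟩ := (mem_cocycles_zero a).1 hP
      obtain ⟨r, rfl⟩ := exists_eq_C_of_diff0 ha hf
      refine ⟨![r], (Submodule.mem_bot ℝ).2 ?_⟩
      simp [one_eq_field0, ← map_smul, smul_eq_C_mul]
  · have hsum (r : Fin 3 → ℝ) : ∑ i, r i • (![Y1, Y2, Y3] : Fin 3 → FormalMultivector 3) i =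
        field1 ((C (r 0) * X 0, C (r 0) * X 1 + C (r 1) * X 0), C (r 2) * X 2) := by
      simp [Fin.sum_univ_three, Y1_eq_field1, Y2_eq_field1, Y3_eq_field1, ← map_smul, ← map_add,
        smul_eq_C_mul]
    refine representsBasis_of ?_ ?_ ?_
    · rw [Fin.forall_fin_succ, Fin.forall_fin_two]
      refine ⟨(mem_cocycles_one a).2 ⟨_, Y1_eq_field1, ?_⟩,
        (mem_cocycles_one a).2 ⟨_, Y2_eq_field1, ?_⟩,
        (mem_cocycles_one a).2 ⟨_, Y3_eq_field1, ?_⟩⟩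
      · simp [diff1, planar0_apply, planar1_apply, lie1_apply, op_apply, Derivation.leibniz,
          pderiv_X_of_ne, pderiv_ofNat_two, Prod.ext_iff, C_two]
        ring
      · simp [diff1, planar0_apply, planar1_apply, lie1_apply, op_apply, Derivation.leibniz,
          pderiv_X_of_ne, Prod.ext_iff]
      · simp [diff1, planar0_apply, planar1_apply, lie1_apply, op_apply, pderiv_X_of_ne,
          Prod.ext_iff, C_two]
    · intro r hr
      rw [hsum] at hr
      obtain ⟨f, hf⟩ := (field1_mem_coboundaries a).1 hr
      obtain ⟨h0, h1, h2⟩ := eq_zero_of_eq_diff0 hf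
      ext i; fin_cases i <;> assumption
    · intro P hP
      obtain ⟨V, rfl, hV⟩ := (mem_cocycles_one a).1 hP
      obtain ⟨f, p, q, r, rfl⟩ := exists_eq_of_diff1_eq_zero ha hV
      refine ⟨![p, q, r], ?_⟩
      rw [hsum, ← map_sub]
      exact (field1_mem_coboundaries a).2 ⟨f, by simp⟩
  · have hsum (r : Fin 3 → ℝ) : ∑ i, r i • (![Y2 * Y3, Y3 * Y1,
          (2 : ℝ) • (y * z * (d3 * d1)) + y ^ 2 * (d1 * d2)] : Fin 3 → FormalMultivector 3) i =
        field2 (C (r 2) * X 1 ^ 2, (C (-r 1) * (X 0 * X 2) - 2 * C (r 2) * (X 1 * X 2),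
          C (-r 1) * (X 1 * X 2) + C (r 0) * (X 0 * X 2))) := by
      simp only [Fin.sum_univ_three, Matrix.cons_val_zero, Matrix.cons_val_one, Matrix.cons_val,
        two_smul_yz_add_y_sq_eq, Y2_mul_Y3, Y3_mul_Y1, ← map_smul, ← map_add]
      congr 1
      simp [smul_eq_C_mul]
      constructor <;> ring
    refine representsBasis_of ?_ ?_ ?_
    · rw [Fin.forall_fin_succ, Fin.forall_fin_two]
      refine ⟨(mem_cocycles_two a).2 ⟨_, Y2_mul_Y3, ?_⟩,
        (mem_cocycles_two a).2 ⟨_, Y3_mul_Y1, ?_⟩,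
        (mem_cocycles_two a).2 ⟨_, two_smul_yz_add_y_sq_eq, ?_⟩⟩
      all_goals
        simp [diff2, planar1_apply, lie2_apply, op_apply, Derivation.leibniz,
          pderiv_X_of_ne, pderiv_ofNat_two, C_two]
        ring
    · intro r hr
      rw [hsum] at hr
      obtain ⟨V, hV⟩ := (field2_mem_coboundaries a).1 hr
      obtain ⟨h1, h0, h2⟩ := eq_zero_of_eq_diff1 hV
      ext i; fin_cases i
      · exact h0
      · exact neg_eq_zero.1 h1
      · exact h2
    · intro P hP
      obtain ⟨S, rfl, hS⟩ := (mem_cocycles_two a).1 hP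
      obtain ⟨V, p, q, r, rfl⟩ := exists_eq_of_diff2_eq_zero ha hS
      refine ⟨![q, -p, r], ?_⟩
      rw [hsum, ← map_sub]
      exact (field2_mem_coboundaries a).2 ⟨V, by simp⟩
  · have hsum (r : Fin 2 → ℝ) : ∑ i, r i • (![d1 * d2 * d3, y ^ 2 * z * (d1 * d2 * d3)] :
        Fin 2 → FormalMultivector 3) i = field3 (C (r 0) + C (r 1) * (X 1 ^ 2 * X 2)) := by
      simp only [Fin.sum_univ_two, Matrix.cons_val_zero, Matrix.cons_val_one,
        y_sq_mul_z_mul]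
      simp only [d1_mul_d2_mul_d3, ← map_smul, ← map_add]
      simp [smul_eq_C_mul]
    refine representsBasis_of ?_ ?_ ?_
    · rw [Fin.forall_fin_two]
      exact ⟨(mem_cocycles_three a).2 ⟨_, d1_mul_d2_mul_d3⟩,
        (mem_cocycles_three a).2 ⟨_, y_sq_mul_z_mul⟩⟩
    · intro r hr
      rw [hsum] at hr
      obtain ⟨S, hS⟩ := (field3_mem_coboundaries a).1 hr
      obtain ⟨h0, h1⟩ := eq_zero_of_eq_diff2 hS
      ext i; fin_cases i <;> assumption
    · intro P hP
      obtain ⟨t, rfl⟩ := (mem_cocycles_three a).1 hP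
      obtain ⟨S, p, q, rfl⟩ := exists_eq_diff2_add ha t
      refine ⟨![p, q], ?_⟩
      rw [hsum, ← map_sub]
      exact (field3_mem_coboundaries a).2 ⟨S, by simp⟩
  · intro p hp
    have h : cocycles (Λ3 a) p = ⊥ := by
      rw [cocycles, homogeneous_eq_bot hp, bot_inf_eq]
    have : Subsingleton (cocycles (Λ3 a) p) := by rw [h]; infer_instance
    infer_instance
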